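/- Let $d\ge 1$ and let $\|\cdot\|$ denote Lebesgue measure on $\mathbb R^d$. Let $C$ be a random closed set in $\mathbb R^d$ such that, almost surely, $\|C\|>0$ and $C\subset B_{0,\tau}$, where $\tau>0$ is a fixed constant and $B_{0,r}$ is the closed ball of radius $r$ centred at the origin; put $\beta=E\|C\|$. Let $R\subset\mathbb R^d$ be a Borel set with $\|R\|<\infty$ and let $k\ge1$ be an integer. For $\lambda,\delta>0$ let $X_1,X_2,\dots$ be the points of a stationary Poisson process of intensity $\lambda$ in $\mathbb R^d$, and let $C_1,C_2,\dots$ be i.i.d. copies of $C$, independent of $(X_i)_{i\ge1}$. Let $\chi_m(x)$ be the indicator that $x\in X_i+\delta C_i$ for exactly $m$ indices $i$, and let $$V_k=V_k(\lambda,\delta)=\sum_{m=0}^{k-1}\int_R\chi_m(x)\,dx$$ be the $k$-vacancy in $R$. For $y\in\mathbb R^d$ set $B_1(y)=(y+C)\cap C$ and $B_2(y)=(y+C)\cap C^c$. If $\delta=\delta(\lambda)\to0$ as $\lambda\to\infty$ in such a way that $\delta^d\lambda\to\rho$, where $0\le\rho<\infty$, then $$E V_k\to\|R\|\sum_{m=0}^{k-1}\frac{e^{-\rho\beta}(\rho\beta)^m}{m!},$$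 $$E|V_k-EV_k|^p\to0\quad\text{for every }1\le p<\infty,$$ $$\lambda\,\mathrm{Var}(V_k)\to\sigma^2,$$ where $$\sigma^2=\rho\|R\|e^{-2\rho\beta}\sum_{m,n=0}^{k-1}\int_{B_{0,2\tau}}\left(e^{\rho E\|B_1(y)\|}\sum_{l=0}^{\min(m,n)}\frac{(\rho E\|B_1(y)\|)^l}{l!}\cdot\frac{(\rho E\|B_2(y)\|)^{m+n-2l}}{(m-l)!\,(n-l)!}-\frac{(\rho\beta)^{m+n}}{m!\,n!}\right)dy .$$ -/

import Mathlib

open MeasureTheory ProbabilityTheory Filter Topology TopologicalSpace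
open scoped Pointwise Nat ENNReal

noncomputable section

/-- The Fell (hit-or-miss) σ-algebra on the closed subsets of a topological space, generated by
the events "`F` hits `K`" for compact `K`. A random closed set is a measurable map into this
space. -/
instance closedsFellMeasurableSpace {E : Type*} [TopologicalSpace E] :
    MeasurableSpace (Closeds E) :=
  MeasurableSpace.generateFrom
    {S | ∃ K : Set E, IsCompact K ∧ S = {F : Closeds E | ((F : Set E) ∩ K).Nonempty}}

/-- The number (possibly infinite) of indices `i` such that the point `X i` lies in `A`. -/
def pointCount {Ω E : Type*} (X : ℕ → Ω → E) (A : Set E) (ω : Ω) : ℕ∞ :=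
  {i : ℕ | X i ω ∈ A}.encard

/-- The random points `X 0, X 1, …` form a stationary Poisson point process in `ℝ^d` of
intensity `lam`. -/
structure IsStationaryPoisson {d : ℕ} {Ω : Type*} [MeasurableSpace Ω]
    (X : ℕ → Ω → EuclideanSpace ℝ (Fin d)) (lam : ℝ) (P : Measure Ω) : Prop where
  measurable : ∀ i, Measurable (X i)
  count_law : ∀ A : Set (EuclideanSpace ℝ (Fin d)), MeasurableSet A → volume A ≠ ∞ →
    ∀ n : ℕ, P {ω | pointCount X A ω = n} =
      poissonMeasure (Real.toNNReal (lam * volume.real A)) {n}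
  count_indep : ∀ (n : ℕ) (A : Fin n → Set (EuclideanSpace ℝ (Fin d))),
    (∀ j, MeasurableSet (A j)) → (∀ j, volume (A j) ≠ ∞) →
    Pairwise (fun i j => Disjoint (A i) (A j)) →
    iIndepFun (fun j => pointCount X (A j)) P

/-- The Poisson–Boolean model: points `X i` of a stationary Poisson process of intensity `lam`,
and shapes `S i`, i.i.d. copies of the random closed set `C`, independent of the points. -/
structure IsPoissonBoolean {d : ℕ} {Ω Ω₀ : Type*} [MeasurableSpace Ω] [MeasurableSpace Ω₀]
    (X : ℕ → Ω → EuclideanSpace ℝ (Fin d)) (S : ℕ → Ω → Closeds (EuclideanSpace ℝ (Fin d)))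
    (lam : ℝ) (P : Measure Ω)
    (C : Ω₀ → Closeds (EuclideanSpace ℝ (Fin d))) (Q : Measure Ω₀) : Prop where
  poisson : IsStationaryPoisson X lam P
  shape_measurable : ∀ i, Measurable (S i)
  shape_law : ∀ i, IdentDistrib (S i) C P Q
  shape_indep : iIndepFun S P
  indep : IndepFun (fun ω i => X i ω) (fun ω i => S i ω) P

/-- The number of indices `i` with `x ∈ X i + δ S i`. -/
def coverCount {d : ℕ} {Ω : Type*} (X : ℕ → Ω → EuclideanSpace ℝ (Fin d))
    (S : ℕ → Ω → Closeds (EuclideanSpace ℝ (Fin d))) (δ : ℝ)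
    (x : EuclideanSpace ℝ (Fin d)) (ω : Ω) : ℕ∞ :=
  {i : ℕ | x ∈ X i ω +ᵥ δ • (S i ω : Set (EuclideanSpace ℝ (Fin d)))}.encard

open Classical in
/-- `χ_m(x)`: the indicator that `x` is covered by exactly `m` of the sets `X i + δ S i`. -/
def coverIndicator {d : ℕ} {Ω : Type*} (X : ℕ → Ω → EuclideanSpace ℝ (Fin d))
    (S : ℕ → Ω → Closeds (EuclideanSpace ℝ (Fin d))) (δ : ℝ) (m : ℕ)
    (x : EuclideanSpace ℝ (Fin d)) (ω : Ω) : ℝ :=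
  if coverCount X S δ x ω = m then 1 else 0

/-- The `k`-vacancy in `R`: the volume of the part of `R` covered by at most `k - 1` of the sets
`X i + δ S i`. -/
def kVacancy {d : ℕ} {Ω : Type*} (X : ℕ → Ω → EuclideanSpace ℝ (Fin d))
    (S : ℕ → Ω → Closeds (EuclideanSpace ℝ (Fin d))) (δ : ℝ)
    (R : Set (EuclideanSpace ℝ (Fin d))) (k : ℕ) (ω : Ω) : ℝ :=
  ∑ m ∈ Finset.range k, ∫ x in R, coverIndicator X S δ m x ω

/-- `β = E‖C‖`, the mean volume of the shape. -/
def meanVolume {d : ℕ} {Ω₀ : Type*} [MeasurableSpace Ω₀]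
    (C : Ω₀ → Closeds (EuclideanSpace ℝ (Fin d))) (Q : Measure Ω₀) : ℝ :=
  ∫ ω, volume.real (C ω : Set (EuclideanSpace ℝ (Fin d))) ∂Q

/-- `E‖B₁(y)‖`, where `B₁(y) = (y + C) ∩ C`. -/
def meanB1 {d : ℕ} {Ω₀ : Type*} [MeasurableSpace Ω₀]
    (C : Ω₀ → Closeds (EuclideanSpace ℝ (Fin d))) (Q : Measure Ω₀)
    (y : EuclideanSpace ℝ (Fin d)) : ℝ :=
  ∫ ω, volume.real ((y +ᵥ (C ω : Set (EuclideanSpace ℝ (Fin d)))) ∩ (C ω : Set _)) ∂Q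

/-- `E‖B₂(y)‖`, where `B₂(y) = (y + C) ∩ Cᶜ`. -/
def meanB2 {d : ℕ} {Ω₀ : Type*} [MeasurableSpace Ω₀]
    (C : Ω₀ → Closeds (EuclideanSpace ℝ (Fin d))) (Q : Measure Ω₀)
    (y : EuclideanSpace ℝ (Fin d)) : ℝ :=
  ∫ ω, volume.real ((y +ᵥ (C ω : Set (EuclideanSpace ℝ (Fin d)))) ∩ (C ω : Set _)ᶜ) ∂Q

/-- The limiting variance `σ²`. -/
def sigmaSq {d : ℕ} {Ω₀ : Type*} [MeasurableSpace Ω₀]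
    (C : Ω₀ → Closeds (EuclideanSpace ℝ (Fin d))) (Q : Measure Ω₀) (τ ρ : ℝ)
    (R : Set (EuclideanSpace ℝ (Fin d))) (k : ℕ) : ℝ :=
  ρ * volume.real R * Real.exp (-2 * ρ * meanVolume C Q) *
    ∑ m ∈ Finset.range k, ∑ n ∈ Finset.range k,
      ∫ y in Metric.closedBall (0 : EuclideanSpace ℝ (Fin d)) (2 * τ),
        (Real.exp (ρ * meanB1 C Q y) *
            ∑ l ∈ Finset.range (min m n + 1),
              ((ρ * meanB1 C Q y) ^ l / (l ! : ℝ)) *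
                ((ρ * meanB2 C Q y) ^ (m + n - 2 * l) / (((m - l)! : ℝ) * ((n - l)! : ℝ)))
          - (ρ * meanVolume C Q) ^ (m + n) / ((m ! : ℝ) * (n ! : ℝ)))

end

/-! By Fubini, the mean and variance of V_k are integrals over R and R × R of one-point and
two-point probabilities, so everything rests on the joint law of the numbers N₁, N₂ of sets covering
two points z₁, z₂. This law is explicit for every λ. Put a = δ^d λ and b = E‖B₁((z₂ - z₁)/δ)‖. The
generating functional of the marked Poisson process (`integral_finprod_marks`) gives E u^N₁ v^N₂ =
exp(a((u-1)(v-1)b + (u-1)β + (v-1)β)) (`integral_pow_coverCount_mul_pow`). Comparing power series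
coefficients, first in u and then in v, yields P(N₁ = m, N₂ = n)
(`measureReal_coverCount_eq_inter`).

Hence the covariance of the indicators of N < k at x and x' is a kernel κ_a((x' - x)/δ) that
vanishes beyond distance 2τ (`covariance_eq_covKernel`). Substituting x' = x + δy gives Var V_k =
δ^d ∫ κ_a(y) ‖R ∩ (R - δy)‖ dy (`variance_kVacancy`). After multiplication by λ the prefactor is a →
ρ, while κ_a → κ_ρ by continuity in a and ‖R ∩ (R - δy)‖ → ‖R‖ by continuity of translations in
measure. Being a covariance, κ_a is bounded uniformly, so dominated convergence produces σ².

The mean is a Poisson sum, continuous in a. Finally Var V_k → 0 because λ Var V_k converges, and for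
variables bounded uniformly in λ this controls every absolute central moment of order p ≥ 1. -/

/-! ### Measurability for the Fell σ-algebra and for counts -/

theorem measurableSet_closeds_hit {E : Type*} [TopologicalSpace E] {K : Set E} (hK : IsCompact K) :
    MeasurableSet {F : Closeds E | ((F : Set E) ∩ K).Nonempty} :=
  MeasurableSpace.measurableSet_generateFrom ⟨K, hK, rfl⟩

/-- Since F is closed, x ∈ F holds iff at every scale 1/(n+1) some point of a dense sequence is
close both to x and to a point of F. This is a countable combination of open balls and hitting
events, and it provides the joint measurability behind every use of Fubini below. -/
theorem measurableSet_mem_closeds {E : Type*} [PseudoMetricSpace E] [ProperSpace E]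
    [SecondCountableTopology E] [MeasurableSpace E] [OpensMeasurableSpace E] :
    MeasurableSet {p : E × Closeds E | p.1 ∈ p.2} := by
  rcases isEmpty_or_nonempty E with hE | hE
  · have : IsEmpty (E × Closeds E) := Prod.isEmpty_left
    rw [Set.eq_empty_of_isEmpty {p : E × Closeds E | p.1 ∈ p.2}]
    exact MeasurableSet.empty
  have key : {p : E × Closeds E | p.1 ∈ p.2} = ⋂ n : ℕ, ⋃ j : ℕ,
      Metric.ball (denseSeq E j) (1 / ((n : ℝ) + 1)) ×ˢ
        {F : Closeds E | ((F : Set E) ∩ Metric.closedBall (denseSeq E j) (1 / ((n : ℝ) + 1))).Nonempty} := by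
    ext ⟨x, F⟩
    simp only [Set.mem_ofPred_eq, Set.mem_iInter, Set.mem_iUnion, Set.mem_prod]
    constructor
    · intro hx n
      obtain ⟨j, hj⟩ := (denseRange_denseSeq E).exists_dist_lt x
        (show (0 : ℝ) < 1 / ((n : ℝ) + 1) by positivity)
      exact ⟨j, hj, x, hx, hj.le⟩
    · intro h
      have : x ∈ closure (F : Set E) := by
        rw [Metric.mem_closure_iff]
        intro ε hε
        obtain ⟨n, hn⟩ := exists_nat_one_div_lt (half_pos hε)
        obtain ⟨j, hj, z, hz, hzj⟩ := h n
        refine ⟨z, hz, ?_⟩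
        have h1 := dist_triangle_right x z (denseSeq E j)
        have h2 : dist x (denseSeq E j) < 1 / ((n : ℝ) + 1) := hj
        have h3 : dist z (denseSeq E j) ≤ 1 / ((n : ℝ) + 1) := hzj
        linarith
      rwa [F.isClosed.closure_eq] at this
  rw [key]
  exact MeasurableSet.iInter fun n => MeasurableSet.iUnion fun j =>
    Metric.isOpen_ball.measurableSet.prod (measurableSet_closeds_hit (isCompact_closedBall _ _))

/-- F leaves the ball iff it hits one of countably many compact shells. Measurability lets the
almost sure bound on C pass to its copies through their common law. -/
theorem measurableSet_closeds_subset_closedBall {E : Type*} [PseudoMetricSpace E] [ProperSpace E]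
    (c : E) (r : ℝ) : MeasurableSet {F : Closeds E | (F : Set E) ⊆ Metric.closedBall c r} := by
  have key : {F : Closeds E | (F : Set E) ⊆ Metric.closedBall c r}ᶜ = ⋃ n : ℕ,
      {F : Closeds E | ((F : Set E) ∩
        (Metric.closedBall c n ∩ {z | r + 1 / ((n : ℝ) + 1) ≤ dist z c})).Nonempty} := by
    ext F
    simp only [Set.mem_compl_iff, Set.mem_ofPred_eq, Set.mem_iUnion, Set.not_subset]
    constructor
    · rintro ⟨z, hz, hzr⟩
      have hzr' : 0 < dist z c - r := by simpa using hzr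
      obtain ⟨n, hn⟩ := exists_nat_one_div_lt hzr'
      obtain ⟨m, hm⟩ := exists_nat_ge (dist z c)
      refine ⟨max n m, z, hz, hm.trans (by simp), ?_⟩
      have : 1 / (((max n m : ℕ) : ℝ) + 1) ≤ 1 / ((n : ℝ) + 1) :=
        one_div_le_one_div_of_le (by positivity) (by simp)
      simp only [Set.mem_ofPred_eq]
      linarith
    · rintro ⟨n, z, hz, -, hzr⟩
      refine ⟨z, hz, ?_⟩
      have : (0 : ℝ) < 1 / ((n : ℝ) + 1) := by positivity
      simp only [Set.mem_ofPred_eq] at hzr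
      simp only [Metric.mem_closedBall, not_le]
      linarith
  rw [← MeasurableSet.compl_iff, key]
  refine MeasurableSet.iUnion fun n => measurableSet_closeds_hit ?_
  exact (isCompact_closedBall c _).inter_right
    (isClosed_le continuous_const (continuous_id.dist continuous_const))

theorem measurable_encard_setOf_mem {α : Type*} [MeasurableSpace α] {A : ℕ → Set α}
    (hA : ∀ i, MeasurableSet (A i)) : Measurable fun a => {i : ℕ | a ∈ A i}.encard := by
  have h1 : Measurable fun a => (({i : ℕ | a ∈ A i}.encard : ℕ∞) : ℝ≥0∞) := by
    have : (fun a => (({i : ℕ | a ∈ A i}.encard : ℕ∞) : ℝ≥0∞)) =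
        fun a => ∑' i, (A i).indicator (fun _ => (1 : ℝ≥0∞)) a := by
      ext a
      rw [← ENNReal.tsum_set_one, tsum_subtype {i : ℕ | a ∈ A i} (fun _ => (1 : ℝ≥0∞))]
      rfl
    rw [this]
    exact Measurable.tsum fun i => measurable_const.indicator (hA i)
  refine measurable_to_countable' fun y => ?_
  have : (fun a => {i : ℕ | a ∈ A i}.encard) ⁻¹' {y} =
      (fun a => (({i : ℕ | a ∈ A i}.encard : ℕ∞) : ℝ≥0∞)) ⁻¹' {(y : ℝ≥0∞)} := by
    ext a; simp
  rw [this]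
  exact h1 (measurableSet_singleton _)

theorem mem_vadd_smul_set_iff {E : Type*} [AddCommGroup E] [Module ℝ E] {δ : ℝ} (hδ : δ ≠ 0)
    (x v : E) (F : Set E) : x ∈ v +ᵥ δ • F ↔ δ⁻¹ • (x - v) ∈ F := by
  rw [Set.mem_vadd_set_iff_neg_vadd_mem, Set.mem_smul_set_iff_inv_smul_mem₀ hδ, vadd_eq_add,
    neg_add_eq_sub]

theorem measurableSet_mem_scaled_closeds {d : ℕ} {α : Type*} [MeasurableSpace α] {δ : ℝ}
    (hδ : δ ≠ 0) {z x : α → EuclideanSpace ℝ (Fin d)} {F : α → Closeds (EuclideanSpace ℝ (Fin d))}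
    (hz : Measurable z) (hx : Measurable x) (hF : Measurable F) :
    MeasurableSet {a | z a ∈ x a +ᵥ δ • (F a : Set (EuclideanSpace ℝ (Fin d)))} := by
  simp only [mem_vadd_smul_set_iff hδ]
  have : Measurable fun a => (δ⁻¹ • (z a - x a), F a) := by fun_prop
  exact this measurableSet_mem_closeds

theorem measurable_pointCount {Ω E : Type*} [MeasurableSpace Ω] [MeasurableSpace E]
    {X : ℕ → Ω → E} (hX : ∀ i, Measurable (X i)) {A : Set E} (hA : MeasurableSet A) :
    Measurable (pointCount X A) :=
  measurable_encard_setOf_mem (A := fun i => X i ⁻¹' A) fun i => hX i hA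

theorem measurable_coverCount {d : ℕ} {Ω : Type*} [MeasurableSpace Ω]
    {X : ℕ → Ω → EuclideanSpace ℝ (Fin d)} {S : ℕ → Ω → Closeds (EuclideanSpace ℝ (Fin d))}
    {δ : ℝ} (hδ : δ ≠ 0) (hX : ∀ i, Measurable (X i)) (hS : ∀ i, Measurable (S i)) :
    Measurable fun p : EuclideanSpace ℝ (Fin d) × Ω => coverCount X S δ p.1 p.2 :=
  measurable_encard_setOf_mem (A := fun i => {p : EuclideanSpace ℝ (Fin d) × Ω |
      p.1 ∈ X i p.2 +ᵥ δ • (S i p.2 : Set (EuclideanSpace ℝ (Fin d)))}) fun i =>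
    measurableSet_mem_scaled_closeds hδ measurable_fst ((hX i).comp measurable_snd)
      ((hS i).comp measurable_snd)

/-! ### Generating functionals of Poisson processes, without and with marks -/

theorem integral_pow_poissonMeasure (r : NNReal) (c : ℝ) :
    ∫ n, c ^ n ∂(poissonMeasure r) = Real.exp (r * (c - 1)) := by
  rw [integral_poissonMeasure]
  have h := (NormedSpace.expSeries_div_hasSum_exp ((r : ℝ) * c)).mul_left (Real.exp (-r))
  rw [← Real.exp_eq_exp_ℝ, ← Real.exp_add] at h
  rw [show (r : ℝ) * (c - 1) = -r + r * c by ring, ← h.tsum_eq]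
  congr with n
  rw [mul_pow, smul_eq_mul]
  ring

/-- No finiteness is needed, as `finprod` takes the value 1 on an infinite support; so the bound
dominates at every ω, exceptional ones included. -/
theorem abs_finprod_le_one {ι : Type*} {f : ι → ℝ} (hf : ∀ i, |f i| ≤ 1) : |∏ᶠ i, f i| ≤ 1 := by
  refine finprod_induction (fun x : ℝ => |x| ≤ 1) (by simp) (fun x y hx hy => ?_) hf
  rw [abs_mul]
  exact mul_le_one₀ hx (abs_nonneg _) hy

open Classical in
theorem tendsto_prod_range_finprod {f : ℕ → ℝ} {s : Set ℕ} (hs : s.Finite)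
    (hf : ∀ i ∉ s, f i = 1) :
    Tendsto (fun n => ∏ i ∈ Finset.range n, f i) atTop (𝓝 (∏ᶠ i, f i)) := by
  have h : HasProd f (∏ i ∈ hs.toFinset, f i) :=
    hasProd_prod_of_ne_finset_one fun i hi => hf i (by simpa using hi)
  rw [finprod_eq_prod_of_mulSupport_subset f (s := hs.toFinset)]
  · exact h.tendsto_prod_nat
  · intro i hi
    by_contra hn
    exact hi (hf i (by simpa using hn))

namespace IsStationaryPoisson

variable {d : ℕ} {Ω : Type*} [MeasurableSpace Ω] {X : ℕ → Ω → EuclideanSpace ℝ (Fin d)}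
  {lam : ℝ} {P : Measure Ω} [IsProbabilityMeasure P]

/-- The model prescribes the mass of finite values only; since both measures have total mass 1, they
also agree at ⊤. -/
theorem map_pointCount (hX : IsStationaryPoisson X lam P) {A : Set (EuclideanSpace ℝ (Fin d))}
    (hA : MeasurableSet A) (hAfin : volume A ≠ ∞) :
    P.map (pointCount X A) =
      (poissonMeasure (Real.toNNReal (lam * volume.real A))).map (Nat.cast : ℕ → ℕ∞) := by
  have hm := measurable_pointCount hX.measurable hA
  have : IsProbabilityMeasure (P.map (pointCount X A)) := Measure.isProbabilityMeasure_map hm.aemeasurable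
  have hnat : ∀ n : ℕ, P.map (pointCount X A) {(n : ℕ∞)} =
      (poissonMeasure (Real.toNNReal (lam * volume.real A))).map (Nat.cast : ℕ → ℕ∞) {(n : ℕ∞)} := by
    intro n
    rw [Measure.map_apply hm (measurableSet_singleton _),
      Measure.map_apply .of_discrete (measurableSet_singleton _)]
    have : (Nat.cast : ℕ → ℕ∞) ⁻¹' {(n : ℕ∞)} = {n} := by ext; simp
    rw [this, ← hX.count_law A hA hAfin n]
    rfl
  refine Measure.ext_of_singleton fun y => ?_
  induction y using ENat.recTopCoe with
  | coe n => exact hnat n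
  | top =>
    have hcompl : ({⊤} : Set ℕ∞) = (⋃ n : ℕ, {(n : ℕ∞)})ᶜ := by
      ext y
      induction y using ENat.recTopCoe <;> simp
    have hU : MeasurableSet (⋃ n : ℕ, {(n : ℕ∞)}) := .of_discrete
    have hd : Pairwise (Function.onFun Disjoint fun n : ℕ => ({(n : ℕ∞)} : Set ℕ∞)) := by
      intro a b hab
      simpa [Function.onFun] using hab
    rw [hcompl, prob_compl_eq_one_sub hU, prob_compl_eq_one_sub hU,
      measure_iUnion hd fun _ => .of_discrete, measure_iUnion hd fun _ => .of_discrete]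
    simp_rw [hnat]

theorem ae_pointCount_ne_top (hX : IsStationaryPoisson X lam P)
    {A : Set (EuclideanSpace ℝ (Fin d))} (hA : MeasurableSet A) (hAfin : volume A ≠ ∞) :
    ∀ᵐ ω ∂P, pointCount X A ω ≠ ⊤ := by
  have hm := measurable_pointCount hX.measurable hA
  have h : ∀ᵐ y ∂(P.map (pointCount X A)), y ≠ ⊤ := by
    rw [hX.map_pointCount hA hAfin, ae_map_iff .of_discrete .of_discrete]
    simp
  exact ae_of_ae_map hm.aemeasurable h

theorem ae_finite_setOf_mem (hX : IsStationaryPoisson X lam P)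
    {A : Set (EuclideanSpace ℝ (Fin d))} (hA : MeasurableSet A) (hAfin : volume A ≠ ∞) :
    ∀ᵐ ω ∂P, {i | X i ω ∈ A}.Finite := by
  filter_upwards [hX.ae_pointCount_ne_top hA hAfin] with ω hω
  exact Set.encard_ne_top_iff.1 hω

theorem integral_pow_pointCount (hX : IsStationaryPoisson X lam P) (hlam : 0 ≤ lam)
    {A : Set (EuclideanSpace ℝ (Fin d))} (hA : MeasurableSet A) (hAfin : volume A ≠ ∞) (c : ℝ) :
    ∫ ω, c ^ (pointCount X A ω).toNat ∂P = Real.exp (lam * volume.real A * (c - 1)) := by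
  have hm := measurable_pointCount hX.measurable hA
  have h := integral_map hm.aemeasurable (μ := P)
    (f := fun y : ℕ∞ => c ^ y.toNat) (Measurable.of_discrete).aestronglyMeasurable
  rw [← h, hX.map_pointCount hA hAfin,
    integral_map .of_discrete (Measurable.of_discrete).aestronglyMeasurable]
  simp only [ENat.toNat_natCast]
  rw [integral_pow_poissonMeasure, Real.coe_toNNReal _ (by positivity)]

open Classical in
-- The level sets of f cut B into disjoint pieces. Grouping the factors by the value c of f gives a
-- product of powers c ^ N(A_c) of independent Poisson counts, whose means are known.
theorem integral_finprod_simpleFunc (hX : IsStationaryPoisson X lam P) (hlam : 0 ≤ lam)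
    {B : Set (EuclideanSpace ℝ (Fin d))} (hB : MeasurableSet B) (hBfin : volume B ≠ ∞)
    (f : SimpleFunc (EuclideanSpace ℝ (Fin d)) ℝ) :
    ∫ ω, ∏ᶠ i, B.piecewise f 1 (X i ω) ∂P = Real.exp (lam * ∫ x in B, (f x - 1)) := by
  let e : Fin f.range.card ≃ f.range := f.range.equivFin.symm
  let A : Fin f.range.card → Set (EuclideanSpace ℝ (Fin d)) := fun j => f ⁻¹' {(e j : ℝ)} ∩ B
  have hA : ∀ j, MeasurableSet (A j) := fun j => (f.measurableSet_preimage _).inter hB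
  have hAfin : ∀ j, volume (A j) ≠ ∞ := fun j =>
    ne_top_of_le_ne_top hBfin (measure_mono Set.inter_subset_right)
  have hdisj : Pairwise fun i j => Disjoint (A i) (A j) := by
    intro i j hij
    refine Set.disjoint_left.2 fun x hx hx' => hij (e.injective (Subtype.ext ?_))
    exact hx.1.symm.trans hx'.1
  have hprod : ∀ h : ℝ → ℝ, ∏ j, h (e j) = ∏ c ∈ f.range, h c := fun h => by
    rw [Equiv.prod_comp e (fun c : f.range => h c), Finset.prod_coe_sort f.range h]
  have hsum : ∀ h : ℝ → ℝ, ∑ j, h (e j) = ∑ c ∈ f.range, h c := fun h => by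
    rw [Equiv.sum_comp e (fun c : f.range => h c), Finset.sum_coe_sort f.range h]
  have h1 : (fun ω => ∏ᶠ i, B.piecewise f 1 (X i ω)) =ᵐ[P]
      fun ω => ∏ j, (e j : ℝ) ^ (pointCount X (A j) ω).toNat := by
    filter_upwards [hX.ae_finite_setOf_mem hB hBfin] with ω hω
    rw [finprod_eq_prod_of_mulSupport_subset (s := hω.toFinset),
      hprod fun c => c ^ (pointCount X (f ⁻¹' {c} ∩ B) ω).toNat,
      ← Finset.prod_fiberwise_of_maps_to (t := f.range) (g := fun i => f (X i ω))]
    · refine Finset.prod_congr rfl fun c _ => ?_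
      rw [Finset.prod_congr rfl (g := fun _ => c), Finset.prod_const]
      · congr 1
        rw [pointCount, ← Set.ncard_def, ← Set.ncard_coe_finset]
        congr 1
        ext i
        simp [and_comm]
      · intro i hi
        simp only [Finset.mem_filter, Set.Finite.mem_toFinset, Set.mem_ofPred_eq] at hi
        rw [Set.piecewise_eq_of_mem _ _ _ hi.1, hi.2]
    · intro i _
      exact f.mem_range_self _
    · intro i hi
      simp only [Set.Finite.coe_toFinset, Set.mem_ofPred_eq]
      by_contra hn
      exact hi (by simp [Set.piecewise_eq_of_notMem _ _ _ hn])
  have hind := (hX.count_indep _ A hA hAfin hdisj).comp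
    (fun j (y : ℕ∞) => (e j : ℝ) ^ y.toNat) fun _ => .of_discrete
  rw [integral_congr_ae h1]
  have h2 := hind.integral_fun_prod_eq_prod_integral fun j =>
    ((Measurable.of_discrete (f := fun y : ℕ∞ => (e j : ℝ) ^ y.toNat)).comp
      (measurable_pointCount hX.measurable (hA j))).aestronglyMeasurable
  simp only [Function.comp_apply] at h2
  rw [h2]
  simp_rw [hX.integral_pow_pointCount hlam (hA _) (hAfin _)]
  rw [← Real.exp_sum, hsum fun c => lam * volume.real (f ⁻¹' {c} ∩ B) * (c - 1)]
  congr 1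
  have hfin : IsFiniteMeasure (volume.restrict B) := ⟨by simpa using hBfin.lt_top⟩
  have hint := SimpleFunc.integrable_of_isFiniteMeasure (μ := volume.restrict B) f
  have h3 : ∫ x in B, f x = ∑ c ∈ f.range, volume.real (f ⁻¹' {c} ∩ B) * c := by
    rw [← SimpleFunc.integral_eq_integral f hint, SimpleFunc.integral_eq]
    refine Finset.sum_congr rfl fun c _ => ?_
    rw [measureReal_restrict_apply (f.measurableSet_preimage _), smul_eq_mul]
  have h4 : volume.real B = ∑ c ∈ f.range, volume.real (f ⁻¹' {c} ∩ B) := by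
    have h5 := sum_measureReal_preimage_singleton (μ := volume.restrict B) f.range
      (fun c _ => f.measurableSet_preimage {c})
    simp_rw [measureReal_restrict_apply (f.measurableSet_preimage _)] at h5
    rw [h5, Set.preimage_eq_univ_iff.2 f.coe_range.ge, Set.univ_inter]
  rw [integral_sub hint (integrable_const _), h3, setIntegral_const, h4, smul_eq_mul, mul_one,
    ← Finset.sum_sub_distrib, Finset.mul_sum]
  exact Finset.sum_congr rfl fun c _ => by ring

open Classical in
/-- The probability generating functional of a stationary Poisson process. -/
theorem integral_finprod (hX : IsStationaryPoisson X lam P) (hlam : 0 ≤ lam)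
    {B : Set (EuclideanSpace ℝ (Fin d))} (hB : MeasurableSet B) (hBfin : volume B ≠ ∞)
    {G : EuclideanSpace ℝ (Fin d) → ℝ} (hG : Measurable G) (hG1 : ∀ x, |G x| ≤ 1) :
    ∫ ω, ∏ᶠ i, B.piecewise G 1 (X i ω) ∂P = Real.exp (lam * ∫ x in B, (G x - 1)) := by
  have h0 : (0 : ℝ) ∈ Set.Icc (-1 : ℝ) 1 := by simp
  let f : ℕ → SimpleFunc (EuclideanSpace ℝ (Fin d)) ℝ :=
    -- Approximating within [-1, 1] keeps all products bounded by 1, which is the dominating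
    -- function.
    fun n => SimpleFunc.approxOn G hG (Set.Icc (-1) 1) 0 h0 n
  have hf1 : ∀ n x, |f n x| ≤ 1 := fun n x => abs_le.2 (SimpleFunc.approxOn_mem hG h0 n x)
  have hft : ∀ x, Tendsto (fun n => f n x) atTop (𝓝 (G x)) := fun x =>
    SimpleFunc.tendsto_approxOn hG h0 (subset_closure (abs_le.1 (hG1 x)))
  have hpw1 : ∀ g : EuclideanSpace ℝ (Fin d) → ℝ, (∀ x, |g x| ≤ 1) → ∀ x, |B.piecewise g 1 x| ≤ 1 := by
    intro g hg x
    by_cases hx : x ∈ B <;> simp [hx, hg]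
  have hoff : ∀ (g : EuclideanSpace ℝ (Fin d) → ℝ) (ω : Ω), ∀ i ∉ {i | X i ω ∈ B},
      B.piecewise g 1 (X i ω) = 1 := fun g ω i hi => by
    simp [Set.piecewise_eq_of_notMem _ _ _ (show X i ω ∉ B from hi)]
  have hmeas : ∀ g : EuclideanSpace ℝ (Fin d) → ℝ, Measurable g →
      AEStronglyMeasurable (fun ω => ∏ᶠ i, B.piecewise g 1 (X i ω)) P := by
    intro g hg
    refine aestronglyMeasurable_of_tendsto_ae atTop
      (f := fun n ω => ∏ i ∈ Finset.range n, B.piecewise g 1 (X i ω)) (fun n => ?_) ?_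
    · refine (Finset.measurable_fun_prod _ fun i _ => ?_).aestronglyMeasurable
      exact (hg.piecewise hB measurable_one).comp (hX.measurable i)
    · filter_upwards [hX.ae_finite_setOf_mem hB hBfin] with ω hω
      exact tendsto_prod_range_finprod hω (hoff g ω)
  have hL : Tendsto (fun n => ∫ ω, ∏ᶠ i, B.piecewise (f n) 1 (X i ω) ∂P) atTop
      (𝓝 (∫ ω, ∏ᶠ i, B.piecewise G 1 (X i ω) ∂P)) := by
    refine tendsto_integral_of_dominated_convergence (fun _ => 1) (fun n => hmeas _ (f n).measurable)
      (integrable_const _) (fun n => ae_of_all _ fun ω => abs_finprod_le_one fun i => hpw1 _ (hf1 n) _) ?_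
    filter_upwards [hX.ae_finite_setOf_mem hB hBfin] with ω hω
    have hsub : ∀ g : EuclideanSpace ℝ (Fin d) → ℝ, ∏ᶠ i, B.piecewise g 1 (X i ω) =
        ∏ i ∈ hω.toFinset, B.piecewise g 1 (X i ω) := fun g => by
      refine finprod_eq_prod_of_mulSupport_subset _ fun i hi => ?_
      by_contra hn
      exact hi (hoff g ω i (by simpa using hn))
    simp_rw [hsub]
    refine tendsto_finsetProd _ fun i hi => ?_
    have hi' : X i ω ∈ B := by simpa using hi
    simpa [hi'] using hft (X i ω)
  have hfin : IsFiniteMeasure (volume.restrict B) := ⟨by simpa using hBfin.lt_top⟩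
  have hR : Tendsto (fun n => Real.exp (lam * ∫ x in B, (f n x - 1))) atTop
      (𝓝 (Real.exp (lam * ∫ x in B, (G x - 1)))) := by
    refine (Real.continuous_exp.tendsto _).comp (Tendsto.const_mul _ ?_)
    refine tendsto_integral_of_dominated_convergence (fun _ => 2)
      (fun n => ((f n).measurable.sub_const 1).aestronglyMeasurable) (integrable_const _)
      (fun n => ae_of_all _ fun x => ?_) (ae_of_all _ fun x => (hft x).sub_const 1)
    have := abs_sub (f n x) 1
    have h2 := hf1 n x
    rw [Real.norm_eq_abs]
    simp only [abs_one] at this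
    linarith
  simp_rw [hX.integral_finprod_simpleFunc hlam hB hBfin] at hL
  exact tendsto_nhds_unique hL hR

end IsStationaryPoisson

/-- Averaging over i.i.d. marks that are independent of the marked points. -/
theorem integral_prod_range_marks {Ω Ω₀ E M : Type*} [MeasurableSpace Ω] [MeasurableSpace Ω₀]
    [MeasurableSpace E] [MeasurableSpace M] {P : Measure Ω} [IsProbabilityMeasure P]
    {Q : Measure Ω₀} {X : ℕ → Ω → E} {S : ℕ → Ω → M} {C : Ω₀ → M}
    (hXm : ∀ i, Measurable (X i)) (hSm : ∀ i, Measurable (S i))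
    (hlaw : ∀ i, IdentDistrib (S i) C P Q) (hSi : iIndepFun S P)
    (hXS : IndepFun (fun ω i => X i ω) (fun ω i => S i ω) P)
    {g : E → M → ℝ} (hg : Measurable fun p : E × M => g p.1 p.2) (hg1 : ∀ x F, |g x F| ≤ 1) (n : ℕ) :
    ∫ ω, ∏ i ∈ Finset.range n, g (X i ω) (S i ω) ∂P =
      ∫ ω, ∏ i ∈ Finset.range n, (∫ w, g (X i ω) (C w) ∂Q) ∂P := by
  have hX' : Measurable fun ω i => X i ω := measurable_pi_lambda _ hXm
  have hS' : Measurable fun ω i => S i ω := measurable_pi_lambda _ hSm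
  have hprob1 : IsProbabilityMeasure (P.map fun ω i => X i ω) :=
    Measure.isProbabilityMeasure_map hX'.aemeasurable
  have hprob2 : IsProbabilityMeasure (P.map fun ω i => S i ω) :=
    Measure.isProbabilityMeasure_map hS'.aemeasurable
  let Φ : (ℕ → E) × (ℕ → M) → ℝ := fun p => ∏ i ∈ Finset.range n, g (p.1 i) (p.2 i)
  have hΦ : Measurable Φ := by
    refine Finset.measurable_fun_prod _ fun i _ => ?_
    have h1 : Measurable fun p : (ℕ → E) × (ℕ → M) => (p.1 i, p.2 i) := by fun_prop
    exact hg.comp h1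
  have hΦ1 : ∀ p, ‖Φ p‖ ≤ 1 := fun p => by
    rw [Real.norm_eq_abs, Finset.abs_prod]
    exact Finset.prod_le_one (fun _ _ => abs_nonneg _) fun _ _ => hg1 _ _
  -- With the points frozen, the remaining integral is over finitely many independent marks and
  -- factorizes.
  have hsec : ∀ x : ℕ → E, ∫ s, Φ (x, s) ∂(P.map fun ω i => S i ω) =
      ∏ i ∈ Finset.range n, ∫ w, g (x i) (C w) ∂Q := by
    intro x
    have hgx : ∀ i, Measurable fun F => g (x i) F := fun i =>
      hg.comp (measurable_const.prodMk measurable_id)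
    have hΦx : Measurable fun s => Φ (x, s) := hΦ.comp (measurable_const.prodMk measurable_id)
    rw [integral_map hS'.aemeasurable hΦx.aestronglyMeasurable]
    simp only [Φ]
    simp_rw [Finset.prod_range]
    have h2 := (hSi.precomp (g := fun i : Fin n => (i : ℕ)) Fin.val_injective).comp
      (fun (i : Fin n) F => g (x i) F) fun i => hgx i
    have h3 := h2.integral_fun_prod_eq_prod_integral fun i =>
      ((hgx i).comp (hSm i)).aestronglyMeasurable
    refine h3.trans (Finset.prod_congr rfl fun i _ => ?_)
    exact ((hlaw i).comp (hgx i)).integral_eq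
  calc ∫ ω, ∏ i ∈ Finset.range n, g (X i ω) (S i ω) ∂P
      = ∫ p, Φ p ∂(P.map fun ω => ((fun i => X i ω), (fun i => S i ω))) :=
        (integral_map (hX'.prodMk hS').aemeasurable hΦ.aestronglyMeasurable).symm
    _ = ∫ x, ∫ s, Φ (x, s) ∂(P.map fun ω i => S i ω) ∂(P.map fun ω i => X i ω) := by
        rw [(indepFun_iff_map_prod_eq_prod_map_map hX'.aemeasurable hS'.aemeasurable).1 hXS]
        refine integral_prod _ (Integrable.of_bound hΦ.aestronglyMeasurable 1 (ae_of_all _ hΦ1))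
    _ = ∫ ω, ∫ s, Φ ((fun i => X i ω), s) ∂(P.map fun ω i => S i ω) ∂P :=
        integral_map hX'.aemeasurable
          hΦ.stronglyMeasurable.integral_prod_right.aestronglyMeasurable
    _ = _ := by simp_rw [hsec]

open Classical in
/-- The probability generating functional of an independently marked stationary Poisson process. -/
theorem integral_finprod_marks {d : ℕ} {Ω Ω₀ M : Type*} [MeasurableSpace Ω] [MeasurableSpace Ω₀]
    [MeasurableSpace M] {P : Measure Ω} [IsProbabilityMeasure P]
    {Q : Measure Ω₀} [IsProbabilityMeasure Q] {X : ℕ → Ω → EuclideanSpace ℝ (Fin d)}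
    {S : ℕ → Ω → M} {C : Ω₀ → M} {lam : ℝ} (hlam : 0 ≤ lam)
    (hX : IsStationaryPoisson X lam P) (hSm : ∀ i, Measurable (S i)) (hC : Measurable C)
    (hlaw : ∀ i, IdentDistrib (S i) C P Q) (hSi : iIndepFun S P)
    (hXS : IndepFun (fun ω i => X i ω) (fun ω i => S i ω) P)
    {B : Set (EuclideanSpace ℝ (Fin d))} (hB : MeasurableSet B) (hBfin : volume B ≠ ∞)
    {g : EuclideanSpace ℝ (Fin d) → M → ℝ}
    (hg : Measurable fun p : EuclideanSpace ℝ (Fin d) × M => g p.1 p.2) (hg1 : ∀ x F, |g x F| ≤ 1) :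
    ∫ ω, ∏ᶠ i, (if X i ω ∈ B then g (X i ω) (S i ω) else 1) ∂P =
      Real.exp (lam * ∫ x in B, ((∫ w, g x (C w) ∂Q) - 1)) := by
  -- Factors are set to 1 off B, so almost surely only finitely many are nontrivial and the products
  -- over initial segments become eventually constant.
  let g' : EuclideanSpace ℝ (Fin d) → M → ℝ := fun x F => if x ∈ B then g x F else 1
  have hg' : Measurable fun p : EuclideanSpace ℝ (Fin d) × M => g' p.1 p.2 :=
    Measurable.ite (measurable_fst hB) hg measurable_const
  have hg1' : ∀ x F, |g' x F| ≤ 1 := fun x F => by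
    by_cases hx : x ∈ B <;> simp [g', hx, hg1]
  let G : EuclideanSpace ℝ (Fin d) → ℝ := fun x => ∫ w, g x (C w) ∂Q
  have hgC : Measurable fun p : EuclideanSpace ℝ (Fin d) × Ω₀ => g p.1 (C p.2) :=
    hg.comp (measurable_fst.prodMk (hC.comp measurable_snd))
  have hG : Measurable G := hgC.stronglyMeasurable.integral_prod_right.measurable
  have hG1 : ∀ x, |G x| ≤ 1 := fun x => by
    have := norm_integral_le_of_norm_le_const (μ := Q) (f := fun w => g x (C w)) (C := 1)
      (ae_of_all _ fun w => hg1 x (C w))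
    simpa using this
  have hGp : ∀ x, ∫ w, g' x (C w) ∂Q = B.piecewise G 1 x := fun x => by
    by_cases hx : x ∈ B <;> simp [g', hx, G]
  have hGp1 : ∀ x, |B.piecewise G 1 x| ≤ 1 := fun x => by
    by_cases hx : x ∈ B <;> simp [hx, hG1]
  have hfinite := hX.ae_finite_setOf_mem hB hBfin
  rw [← hX.integral_finprod hlam hB hBfin hG hG1]
  have h1 : Tendsto (fun n => ∫ ω, ∏ i ∈ Finset.range n, g' (X i ω) (S i ω) ∂P) atTop
      (𝓝 (∫ ω, ∏ᶠ i, g' (X i ω) (S i ω) ∂P)) := by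
    refine tendsto_integral_of_dominated_convergence (fun _ => 1) (fun n => ?_)
      (integrable_const _) (fun n => ae_of_all _ fun ω => ?_) ?_
    · refine (Finset.measurable_fun_prod _ fun i _ => ?_).aestronglyMeasurable
      exact hg'.comp ((hX.measurable i).prodMk (hSm i))
    · rw [Real.norm_eq_abs, Finset.abs_prod]
      exact Finset.prod_le_one (fun _ _ => abs_nonneg _) fun _ _ => hg1' _ _
    · filter_upwards [hfinite] with ω hω
      exact tendsto_prod_range_finprod hω fun i hi =>
        if_neg (show X i ω ∉ B from hi)
  have h2 : Tendsto (fun n => ∫ ω, ∏ i ∈ Finset.range n, B.piecewise G 1 (X i ω) ∂P) atTop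
      (𝓝 (∫ ω, ∏ᶠ i, B.piecewise G 1 (X i ω) ∂P)) := by
    refine tendsto_integral_of_dominated_convergence (fun _ => 1) (fun n => ?_)
      (integrable_const _) (fun n => ae_of_all _ fun ω => ?_) ?_
    · refine (Finset.measurable_fun_prod _ fun i _ => ?_).aestronglyMeasurable
      exact (hG.piecewise hB measurable_one).comp (hX.measurable i)
    · rw [Real.norm_eq_abs, Finset.abs_prod]
      exact Finset.prod_le_one (fun _ _ => abs_nonneg _) fun _ _ => hGp1 _
    · filter_upwards [hfinite] with ω hω
      exact tendsto_prod_range_finprod hω fun i hi => by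
        simp [Set.piecewise_eq_of_notMem _ _ _ (show X i ω ∉ B from hi)]
  -- Marks are averaged at finite n, where the two sequences of integrals coincide; hence so do
  -- their limits.
  simp_rw [integral_prod_range_marks hX.measurable hSm hlaw hSi hXS hg' hg1', hGp] at h1
  exact tendsto_nhds_unique h1 h2

/-! ### Volumes and overlaps of the shape -/

section Shape

variable {d : ℕ} {Ω₀ : Type*} [MeasurableSpace Ω₀] {Q : Measure Ω₀}
  {C : Ω₀ → Closeds (EuclideanSpace ℝ (Fin d))} {τ : ℝ}

theorem meanB1_nonneg (y : EuclideanSpace ℝ (Fin d)) : 0 ≤ meanB1 C Q y :=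
  integral_nonneg fun _ => measureReal_nonneg

theorem meanB1_eq_zero
    (hCτ : ∀ᵐ ω ∂Q, (C ω : Set (EuclideanSpace ℝ (Fin d))) ⊆ Metric.closedBall 0 τ)
    {y : EuclideanSpace ℝ (Fin d)} (hy : y ∉ Metric.closedBall (0 : EuclideanSpace ℝ (Fin d)) (2 * τ)) :
    meanB1 C Q y = 0 := by
  refine integral_eq_zero_of_ae ?_
  filter_upwards [hCτ] with w hw
  have : (y +ᵥ (C w : Set (EuclideanSpace ℝ (Fin d)))) ∩ (C w : Set _) = ∅ := by
    refine Set.eq_empty_of_forall_notMem fun x hx => hy ?_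
    obtain ⟨⟨z, hz, rfl⟩, hx2⟩ := hx
    have h1 := hw hz
    have h2 := hw hx2
    simp only [Metric.mem_closedBall, dist_zero_right, vadd_eq_add] at h1 h2 ⊢
    have h3 : y = (y + z) - z := by abel
    rw [h3]
    linarith [norm_sub_le (y + z) z]
  simp [this]

variable [IsProbabilityMeasure Q]

theorem measurable_volumeReal_vadd_inter (hC : Measurable C) :
    Measurable fun p : EuclideanSpace ℝ (Fin d) × Ω₀ =>
      volume.real ((p.1 +ᵥ (C p.2 : Set (EuclideanSpace ℝ (Fin d)))) ∩ (C p.2 : Set _)) := by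
  let D : Set ((EuclideanSpace ℝ (Fin d) × Ω₀) × EuclideanSpace ℝ (Fin d)) :=
    {q | (q.2 - q.1.1, C q.1.2).1 ∈ (q.2 - q.1.1, C q.1.2).2} ∩
      {q | (q.2, C q.1.2).1 ∈ (q.2, C q.1.2).2}
  have hC' : Measurable fun q : (EuclideanSpace ℝ (Fin d) × Ω₀) × EuclideanSpace ℝ (Fin d) =>
    C q.1.2 := hC.comp (by fun_prop)
  have hm1 : Measurable fun q : (EuclideanSpace ℝ (Fin d) × Ω₀) × EuclideanSpace ℝ (Fin d) =>
      (q.2 - q.1.1, C q.1.2) := Measurable.prodMk (by fun_prop) hC'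
  have hm2 : Measurable fun q : (EuclideanSpace ℝ (Fin d) × Ω₀) × EuclideanSpace ℝ (Fin d) =>
      (q.2, C q.1.2) := Measurable.prodMk (by fun_prop) hC'
  have hD : MeasurableSet D := (hm1 measurableSet_mem_closeds).inter (hm2 measurableSet_mem_closeds)
  have h := (measurable_measure_prodMk_left (ν := (volume : Measure (EuclideanSpace ℝ (Fin d))))
    hD).ennreal_toReal
  convert h using 2 with p
  rw [measureReal_def]
  congr 2
  ext x
  simp [D, Set.mem_vadd_set_iff_neg_vadd_mem, neg_add_eq_sub]

theorem measurable_volumeReal_coe (hC : Measurable C) :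
    Measurable fun w => volume.real (C w : Set (EuclideanSpace ℝ (Fin d))) := by
  have h := (measurable_volumeReal_vadd_inter hC).comp
    (measurable_const.prodMk measurable_id : Measurable fun w : Ω₀ => ((0 : EuclideanSpace ℝ (Fin d)), w))
  simpa [Function.comp_def] using h

theorem measurable_meanB1 (hC : Measurable C) : Measurable (meanB1 C Q) :=
  (measurable_volumeReal_vadd_inter hC).stronglyMeasurable.integral_prod_right.measurable

theorem volume_ne_top_of_subset_closedBall {E : Type*} [PseudoMetricSpace E] [ProperSpace E]
    [MeasureSpace E] [IsFiniteMeasureOnCompacts (volume : Measure E)] {F : Set E} {c : E} {r : ℝ}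
    (hF : F ⊆ Metric.closedBall c r) : volume F ≠ ∞ :=
  ne_top_of_le_ne_top measure_closedBall_lt_top.ne (measure_mono hF)

theorem integrable_volumeReal_coe (hC : Measurable C)
    (hCτ : ∀ᵐ ω ∂Q, (C ω : Set (EuclideanSpace ℝ (Fin d))) ⊆ Metric.closedBall 0 τ) :
    Integrable (fun w => volume.real (C w : Set (EuclideanSpace ℝ (Fin d)))) Q := by
  refine Integrable.of_bound (measurable_volumeReal_coe hC).aestronglyMeasurable
    (volume.real (Metric.closedBall (0 : EuclideanSpace ℝ (Fin d)) τ)) ?_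
  filter_upwards [hCτ] with w hw
  rw [Real.norm_of_nonneg measureReal_nonneg]
  exact measureReal_mono hw measure_closedBall_lt_top.ne

theorem integrable_volumeReal_vadd_inter (hC : Measurable C)
    (hCτ : ∀ᵐ ω ∂Q, (C ω : Set (EuclideanSpace ℝ (Fin d))) ⊆ Metric.closedBall 0 τ)
    (y : EuclideanSpace ℝ (Fin d)) :
    Integrable (fun w => volume.real ((y +ᵥ (C w : Set (EuclideanSpace ℝ (Fin d)))) ∩ (C w : Set _)))
      Q := by
  refine Integrable.of_bound ((measurable_volumeReal_vadd_inter hC).comp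
    measurable_prodMk_left).aestronglyMeasurable
    (volume.real (Metric.closedBall (0 : EuclideanSpace ℝ (Fin d)) τ)) ?_
  filter_upwards [hCτ] with w hw
  rw [Real.norm_of_nonneg measureReal_nonneg]
  exact measureReal_mono (Set.inter_subset_right.trans hw) measure_closedBall_lt_top.ne

theorem meanB1_le_meanVolume (hC : Measurable C)
    (hCτ : ∀ᵐ ω ∂Q, (C ω : Set (EuclideanSpace ℝ (Fin d))) ⊆ Metric.closedBall 0 τ)
    (y : EuclideanSpace ℝ (Fin d)) : meanB1 C Q y ≤ meanVolume C Q := by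
  refine integral_mono_ae (integrable_volumeReal_vadd_inter hC hCτ y)
    (integrable_volumeReal_coe hC hCτ) ?_
  filter_upwards [hCτ] with w hw
  exact measureReal_mono Set.inter_subset_right (volume_ne_top_of_subset_closedBall hw)

/-- A translate of C has the volume of C. All dependence on y thus goes through `meanB1`, which
ranges over [0, β]. -/
theorem meanB2_eq_sub (hC : Measurable C)
    (hCτ : ∀ᵐ ω ∂Q, (C ω : Set (EuclideanSpace ℝ (Fin d))) ⊆ Metric.closedBall 0 τ)
    (y : EuclideanSpace ℝ (Fin d)) : meanB2 C Q y = meanVolume C Q - meanB1 C Q y := by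
  rw [meanB2, meanVolume, meanB1, ← integral_sub (integrable_volumeReal_coe hC hCτ)
    (integrable_volumeReal_vadd_inter hC hCτ y)]
  refine integral_congr_ae ?_
  filter_upwards [hCτ] with w hw
  have hv : volume (y +ᵥ (C w : Set (EuclideanSpace ℝ (Fin d)))) ≠ ∞ := by
    rw [measure_vadd]
    exact volume_ne_top_of_subset_closedBall hw
  have h := measureReal_inter_add_sdiff (μ := volume)
    (s := y +ᵥ (C w : Set (EuclideanSpace ℝ (Fin d)))) (C w).isClosed.measurableSet hv
  have h2 : volume.real (y +ᵥ (C w : Set (EuclideanSpace ℝ (Fin d)))) =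
    volume.real (C w : Set (EuclideanSpace ℝ (Fin d))) := by
      rw [measureReal_def, measure_vadd, measureReal_def]
  rw [Set.sdiff_eq] at h
  linarith

theorem volumeReal_vadd_neg_smul (F : Set (EuclideanSpace ℝ (Fin d))) {δ : ℝ} (hδ : 0 < δ)
    (z : EuclideanSpace ℝ (Fin d)) : volume.real (z +ᵥ (-δ) • F) = δ ^ d * volume.real F := by
  rw [measureReal_def, measure_vadd, Measure.addHaar_smul, ENNReal.toReal_mul,
    ENNReal.toReal_ofReal (abs_nonneg _), measureReal_def, abs_pow, abs_neg, abs_of_pos hδ,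
    finrank_euclideanSpace_fin]

theorem setOf_mem_vadd_smul (F : Set (EuclideanSpace ℝ (Fin d))) {δ : ℝ} (hδ : 0 < δ)
    (z : EuclideanSpace ℝ (Fin d)) : {x : EuclideanSpace ℝ (Fin d) | z ∈ x +ᵥ δ • F} = z +ᵥ (-δ) • F := by
  ext x
  rw [mem_vadd_smul_set_iff (neg_ne_zero.2 hδ.ne'), Set.mem_ofPred_eq, mem_vadd_smul_set_iff hδ.ne',
    inv_neg, neg_smul, ← smul_neg, neg_sub]

theorem volumeReal_setOf_mem_vadd_smul (F : Set (EuclideanSpace ℝ (Fin d))) {δ : ℝ} (hδ : 0 < δ)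
    (z : EuclideanSpace ℝ (Fin d)) :
    volume.real {x : EuclideanSpace ℝ (Fin d) | z ∈ x +ᵥ δ • F} = δ ^ d * volume.real F := by
  rw [setOf_mem_vadd_smul F hδ, volumeReal_vadd_neg_smul F hδ]

/-- The centres from which δF reaches z form the reflected copy z - δF. In the coordinate w = (z₂ -
x)/δ the two conditions read w ∈ F and w ∈ (z₂ - z₁)/δ + F. -/
theorem volumeReal_setOf_mem_vadd_smul_inter (F : Set (EuclideanSpace ℝ (Fin d))) {δ : ℝ}
    (hδ : 0 < δ) (z₁ z₂ : EuclideanSpace ℝ (Fin d)) :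
    volume.real ({x : EuclideanSpace ℝ (Fin d) | z₁ ∈ x +ᵥ δ • F} ∩ {x : EuclideanSpace ℝ (Fin d) | z₂ ∈ x +ᵥ δ • F}) =
      δ ^ d * volume.real (((δ⁻¹ • (z₂ - z₁)) +ᵥ F) ∩ F) := by
  have h1 : {x : EuclideanSpace ℝ (Fin d) | z₁ ∈ x +ᵥ δ • F} ∩ {x : EuclideanSpace ℝ (Fin d) | z₂ ∈ x +ᵥ δ • F} =
      z₂ +ᵥ (-δ) • (((δ⁻¹ • (z₂ - z₁)) +ᵥ F) ∩ F) := by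
    ext x
    rw [mem_vadd_smul_set_iff (neg_ne_zero.2 hδ.ne'), Set.mem_inter_iff, Set.mem_ofPred_eq,
      Set.mem_ofPred_eq, mem_vadd_smul_set_iff hδ.ne', mem_vadd_smul_set_iff hδ.ne',
      Set.mem_inter_iff, Set.mem_vadd_set_iff_neg_vadd_mem, vadd_eq_add, inv_neg, neg_smul,
      ← smul_neg, neg_sub, ← smul_neg, ← smul_add, neg_sub, sub_add_sub_cancel]
  rw [h1, volumeReal_vadd_neg_smul _ hδ]

end Shape

/-! ### The two-point generating function -/

open Classical in
theorem prod_ite_eq_pow_encard {s : Finset ℕ} {p : ℕ → Prop} (hp : ∀ i, p i → i ∈ s) (u : ℝ) :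
    ∏ i ∈ s, (if p i then u else 1) = u ^ ({i | p i}.encard).toNat := by
  rw [Finset.prod_ite, Finset.prod_const, Finset.prod_const_one, mul_one]
  congr 1
  have : {i | p i} = (↑(s.filter p) : Set ℕ) := by
    ext i
    simpa using hp i
  rw [this, Set.encard_coe_eq_coe_finsetCard, ENat.toNat_natCast]

theorem vadd_smul_subset_closedBall {E : Type*} [SeminormedAddCommGroup E] [NormedSpace ℝ E]
    {F : Set E} {δ τ : ℝ} (hδ : 0 < δ) (hF : F ⊆ Metric.closedBall 0 τ) {x z : E}
    (hz : z ∈ x +ᵥ δ • F) : x ∈ Metric.closedBall z (δ * τ) := by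
  rw [mem_vadd_smul_set_iff hδ.ne'] at hz
  have h := hF hz
  rw [mem_closedBall_zero_iff, norm_smul, norm_inv, Real.norm_of_nonneg hδ.le,
    inv_mul_le_iff₀ hδ] at h
  rwa [Metric.mem_closedBall, dist_comm, dist_eq_norm]

theorem setIntegral_integral_sub_one_swap {E Ω₀ M : Type*} [MeasurableSpace E] [MeasurableSpace Ω₀]
    [MeasurableSpace M] {μ : Measure E} {Q : Measure Ω₀} [IsProbabilityMeasure Q] {C : Ω₀ → M}
    (hC : Measurable C) {B : Set E} (hBfin : μ B ≠ ∞) {g : E → M → ℝ}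
    (hg : Measurable fun p : E × M => g p.1 p.2) (hg1 : ∀ x F, |g x F| ≤ 1) [SFinite μ] :
    ∫ x in B, ((∫ w, g x (C w) ∂Q) - 1) ∂μ = ∫ w, (∫ x in B, (g x (C w) - 1) ∂μ) ∂Q := by
  have hfinB : IsFiniteMeasure (μ.restrict B) := ⟨by simpa using hBfin.lt_top⟩
  have hgC : Measurable fun p : E × Ω₀ => g p.1 (C p.2) :=
    hg.comp (measurable_fst.prodMk (hC.comp measurable_snd))
  have hgint : ∀ x, Integrable (fun w => g x (C w)) Q := fun x =>
    Integrable.of_bound (hgC.comp measurable_prodMk_left).aestronglyMeasurable 1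
      (ae_of_all _ fun w => hg1 x (C w))
  have h1 : ∀ x, (∫ w, g x (C w) ∂Q) - 1 = ∫ w, (g x (C w) - 1) ∂Q := fun x => by
    rw [integral_sub (hgint x) (integrable_const _)]
    simp
  simp_rw [h1]
  refine integral_integral_swap (f := fun x w => g x (C w) - 1)
    (Integrable.of_bound (hgC.sub_const 1).aestronglyMeasurable 2 (ae_of_all _ fun p => ?_))
  have h2 := abs_sub (g p.1 (C p.2)) 1
  have h3 := hg1 p.1 (C p.2)
  rw [abs_one] at h2
  simp only [Function.uncurry, Real.norm_eq_abs]
  linarith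

theorem integral_linearCombination_three {α : Type*} [MeasurableSpace α] {μ : Measure α}
    {f₁ f₂ f₃ : α → ℝ} (h₁ : Integrable f₁ μ) (h₂ : Integrable f₂ μ) (h₃ : Integrable f₃ μ)
    (c₁ c₂ c₃ : ℝ) : ∫ x, (c₁ * f₁ x + c₂ * f₂ x + c₃ * f₃ x) ∂μ =
      c₁ * ∫ x, f₁ x ∂μ + c₂ * ∫ x, f₂ x ∂μ + c₃ * ∫ x, f₃ x ∂μ := by
  have h₁₂ : Integrable (fun x => c₁ * f₁ x + c₂ * f₂ x) μ :=
    (h₁.const_mul c₁).add (h₂.const_mul c₂)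
  rw [integral_add h₁₂ (h₃.const_mul c₃), integral_add (h₁.const_mul c₁) (h₂.const_mul c₂),
    integral_const_mul, integral_const_mul, integral_const_mul]

namespace IsPoissonBoolean

variable {d : ℕ} {Ω Ω₀ : Type*} [MeasurableSpace Ω] [MeasurableSpace Ω₀]
  {X : ℕ → Ω → EuclideanSpace ℝ (Fin d)} {S : ℕ → Ω → Closeds (EuclideanSpace ℝ (Fin d))}
  {lam : ℝ} {P : Measure Ω}
  {C : Ω₀ → Closeds (EuclideanSpace ℝ (Fin d))} {Q : Measure Ω₀}
  {τ δ : ℝ}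

theorem ae_shape_subset (h : IsPoissonBoolean X S lam P C Q)
    (hCτ : ∀ᵐ ω ∂Q, (C ω : Set (EuclideanSpace ℝ (Fin d))) ⊆ Metric.closedBall 0 τ) :
    ∀ᵐ ω ∂P, ∀ i, (S i ω : Set (EuclideanSpace ℝ (Fin d))) ⊆ Metric.closedBall 0 τ :=
  ae_all_iff.2 fun i =>
    (h.shape_law i).symm.ae_snd (measurableSet_closeds_subset_closedBall 0 τ) hCτ

variable [IsProbabilityMeasure P]

/-- A set covering z has its centre within δτ of z, and a ball contains finitely many points.
Generating functions only see `toNat`, which confuses ⊤ with 0, so this exclusion is needed to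
return to the counts themselves. -/
theorem ae_coverCount_ne_top (h : IsPoissonBoolean X S lam P C Q) (hδ : 0 < δ)
    (hCτ : ∀ᵐ ω ∂Q, (C ω : Set (EuclideanSpace ℝ (Fin d))) ⊆ Metric.closedBall 0 τ)
    (z : EuclideanSpace ℝ (Fin d)) : ∀ᵐ ω ∂P, coverCount X S δ z ω ≠ ⊤ := by
  filter_upwards [h.ae_shape_subset hCτ, h.poisson.ae_finite_setOf_mem
    (Metric.isClosed_closedBall (x := z) (ε := δ * τ)).measurableSet measure_closedBall_lt_top.ne]
    with ω hω hfin
  exact Set.encard_ne_top_iff.2 (hfin.subset fun i hi => vadd_smul_subset_closedBall hδ (hω i) hi)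

variable [IsProbabilityMeasure Q]

open Classical in
/-- The joint probability generating function of the numbers of shapes covering two points. -/
theorem integral_pow_coverCount_mul_pow (h : IsPoissonBoolean X S lam P C Q) (hlam : 0 ≤ lam)
    (hδ : 0 < δ) (hC : Measurable C)
    (hCτ : ∀ᵐ ω ∂Q, (C ω : Set (EuclideanSpace ℝ (Fin d))) ⊆ Metric.closedBall 0 τ)
    (z₁ z₂ : EuclideanSpace ℝ (Fin d)) {u v : ℝ} (hu : |u| ≤ 1) (hv : |v| ≤ 1) :
    ∫ ω, u ^ (coverCount X S δ z₁ ω).toNat * v ^ (coverCount X S δ z₂ ω).toNat ∂P =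
      Real.exp (δ ^ d * lam * ((u - 1) * (v - 1) * meanB1 C Q (δ⁻¹ • (z₂ - z₁)) +
        (u - 1) * meanVolume C Q + (v - 1) * meanVolume C Q)) := by
  let D : EuclideanSpace ℝ (Fin d) → Set (EuclideanSpace ℝ (Fin d)) → Set (EuclideanSpace ℝ (Fin d)) :=
    fun z F => {x | z ∈ x +ᵥ δ • F}
  obtain ⟨B, hB, hBfin, hDB₁, hDB₂⟩ : ∃ B : Set (EuclideanSpace ℝ (Fin d)), MeasurableSet B ∧
      volume B ≠ ∞ ∧ (∀ F ⊆ Metric.closedBall (0 : EuclideanSpace ℝ (Fin d)) τ, D z₁ F ⊆ B) ∧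
      ∀ F ⊆ Metric.closedBall (0 : EuclideanSpace ℝ (Fin d)) τ, D z₂ F ⊆ B :=
    ⟨Metric.closedBall z₁ (δ * τ) ∪ Metric.closedBall z₂ (δ * τ),
      Metric.isClosed_closedBall.measurableSet.union Metric.isClosed_closedBall.measurableSet,
      (measure_union_lt_top measure_closedBall_lt_top measure_closedBall_lt_top).ne,
      fun F hF x hx => Or.inl (vadd_smul_subset_closedBall hδ hF hx),
      fun F hF x hx => Or.inr (vadd_smul_subset_closedBall hδ hF hx)⟩
  -- One set contributes u if it covers z₁ and v if it covers z₂, so the product over all sets is u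
  -- ^ N₁ * v ^ N₂.
  let g : EuclideanSpace ℝ (Fin d) → Closeds (EuclideanSpace ℝ (Fin d)) → ℝ := fun x F =>
    (if x ∈ D z₁ F then u else 1) * (if x ∈ D z₂ F then v else 1)
  have hDm : ∀ z, MeasurableSet {p : EuclideanSpace ℝ (Fin d) × Closeds (EuclideanSpace ℝ (Fin d)) |
      p.1 ∈ D z p.2} := fun z =>
    measurableSet_mem_scaled_closeds hδ.ne' measurable_const measurable_fst measurable_snd
  have hg : Measurable fun p : EuclideanSpace ℝ (Fin d) × Closeds (EuclideanSpace ℝ (Fin d)) =>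
      g p.1 p.2 :=
    (Measurable.ite (hDm z₁) measurable_const measurable_const).mul
      (Measurable.ite (hDm z₂) measurable_const measurable_const)
  have hite : ∀ {t : ℝ} (p : Prop), |t| ≤ 1 → |if p then t else 1| ≤ 1 := fun p ht => by
    split_ifs <;> simp [ht]
  have hg1 : ∀ x F, |g x F| ≤ 1 := fun x F => by
    rw [abs_mul]
    exact mul_le_one₀ (hite _ hu) (abs_nonneg _) (hite _ hv)
  have hmarks := integral_finprod_marks hlam h.poisson h.shape_measurable hC h.shape_law
    h.shape_indep h.indep hB hBfin hg hg1
  have hleft : (fun ω => ∏ᶠ i, (if X i ω ∈ B then g (X i ω) (S i ω) else 1)) =ᵐ[P]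
      fun ω => u ^ (coverCount X S δ z₁ ω).toNat * v ^ (coverCount X S δ z₂ ω).toNat := by
    filter_upwards [h.ae_shape_subset hCτ, h.poisson.ae_finite_setOf_mem hB hBfin] with ω hω hfin
    rw [finprod_eq_prod_of_mulSupport_subset (s := hfin.toFinset)]
    · rw [Finset.prod_congr rfl (g := fun i => (if z₁ ∈ X i ω +ᵥ δ • (S i ω : Set (EuclideanSpace ℝ (Fin d))) then u else 1) *
        (if z₂ ∈ X i ω +ᵥ δ • (S i ω : Set (EuclideanSpace ℝ (Fin d))) then v else 1)), Finset.prod_mul_distrib,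
        prod_ite_eq_pow_encard, prod_ite_eq_pow_encard]
      · rfl
      · intro i hi
        simpa using hDB₂ _ (hω i) hi
      · intro i hi
        simpa using hDB₁ _ (hω i) hi
      · intro i hi
        rw [if_pos (by simpa using hi)]
        rfl
    · intro i hi
      by_contra hn
      exact hi (if_neg (by simpa using hn))
  rw [← integral_congr_ae hleft, hmarks]
  have hfinB : IsFiniteMeasure (volume.restrict B) := ⟨by simpa using hBfin.lt_top⟩
  have hfinB : IsFiniteMeasure (volume.restrict B) := ⟨by simpa using hBfin.lt_top⟩
  have hinner : (fun w => ∫ x in B, (g x (C w) - 1)) =ᵐ[Q] fun w =>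
      δ ^ d * ((u - 1) * (v - 1) * volume.real (((δ⁻¹ • (z₂ - z₁)) +ᵥ (C w : Set (EuclideanSpace ℝ (Fin d)))) ∩ (C w : Set (EuclideanSpace ℝ (Fin d)))) +
        (u - 1) * volume.real (C w : Set (EuclideanSpace ℝ (Fin d))) +
        (v - 1) * volume.real (C w : Set (EuclideanSpace ℝ (Fin d)))) := by
    filter_upwards [hCτ] with w hw
    have hm : ∀ z, MeasurableSet (D z (C w)) := fun z =>
      (measurable_id.prodMk measurable_const : Measurable fun x : EuclideanSpace ℝ (Fin d) =>
        (x, C w)) (hDm z)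
    -- Expansion of (1 + (u-1)1_{D₁})(1 + (v-1)1_{D₂}) - 1; the cross term is the source of the
    -- overlap volume.
    have hdec : ∀ x, g x (C w) - 1 =
        (u - 1) * (v - 1) * (D z₁ (C w) ∩ D z₂ (C w)).indicator 1 x +
        (u - 1) * (D z₁ (C w)).indicator 1 x + (v - 1) * (D z₂ (C w)).indicator 1 x := fun x => by
      by_cases h1 : x ∈ D z₁ (C w) <;> by_cases h2 : x ∈ D z₂ (C w) <;> simp [g, h1, h2]
      ring
    have hi : ∀ {A : Set (EuclideanSpace ℝ (Fin d))}, MeasurableSet A →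
        Integrable (fun x => A.indicator (1 : EuclideanSpace ℝ (Fin d) → ℝ) x) (volume.restrict B) :=
      fun hA => (integrable_const (1 : ℝ)).indicator hA
    have hv : ∀ {A : Set (EuclideanSpace ℝ (Fin d))}, MeasurableSet A → A ⊆ B →
        ∫ x in B, A.indicator (1 : EuclideanSpace ℝ (Fin d) → ℝ) x = volume.real A := fun hA hAB => by
      rw [integral_indicator_one hA, measureReal_restrict_apply hA, Set.inter_eq_left.2 hAB]
    simp_rw [hdec]
    rw [integral_linearCombination_three (hi ((hm _).inter (hm _))) (hi (hm _)) (hi (hm _)),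
      hv ((hm _).inter (hm _)) (Set.inter_subset_left.trans (hDB₁ _ hw)), hv (hm _) (hDB₁ _ hw),
      hv (hm _) (hDB₂ _ hw), volumeReal_setOf_mem_vadd_smul_inter _ hδ,
      volumeReal_setOf_mem_vadd_smul _ hδ, volumeReal_setOf_mem_vadd_smul _ hδ]
    ring
  rw [setIntegral_integral_sub_one_swap hC hBfin hg hg1, integral_congr_ae hinner,
    integral_const_mul, integral_linearCombination_three
      (integrable_volumeReal_vadd_inter hC hCτ (δ⁻¹ • (z₂ - z₁))) (integrable_volumeReal_coe hC hCτ)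
      (integrable_volumeReal_coe hC hCτ)]
  congr 1
  simp only [meanB1, meanVolume]
  ring

end IsPoissonBoolean

/-! ### Extracting the joint law from the generating function -/

/-- Convergence at u = 1 forces the coefficients to tend to 0, hence a radius of convergence at
least 1. -/
theorem hasFPowerSeriesOnBall_ofScalars_of_hasSum {c : ℕ → ℝ} {f : ℝ → ℝ}
    (hc : ∀ u : ℝ, |u| ≤ 1 → HasSum (fun n => c n * u ^ n) (f u)) :
    HasFPowerSeriesOnBall f (FormalMultilinearSeries.ofScalars ℝ c) 0 1 where
  r_le := by
    have h1 := (hc 1 (by simp)).summable.tendsto_atTop_zero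
    refine FormalMultilinearSeries.le_radius_of_tendsto (r := 1) (l := 0) _ ?_
    have h2 := h1.norm
    simpa [FormalMultilinearSeries.ofScalars_norm] using h2
  r_pos := one_pos
  hasSum := by
    intro y hy
    have hy' : |y| < 1 := by simpa [enorm, ← NNReal.coe_lt_coe] using hy
    have h := hc y hy'.le
    simpa [FormalMultilinearSeries.ofScalars_apply_eq, mul_comm] using h

/-- Power series agreeing on `[-1, 1]` have the same coefficients. -/
theorem eq_of_hasSum_mul_pow {c e : ℕ → ℝ} {f : ℝ → ℝ}
    (hc : ∀ u : ℝ, |u| ≤ 1 → HasSum (fun n => c n * u ^ n) (f u))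
    (he : ∀ u : ℝ, |u| ≤ 1 → HasSum (fun n => e n * u ^ n) (f u)) : c = e := by
  have h := (hasFPowerSeriesOnBall_ofScalars_of_hasSum hc).hasFPowerSeriesAt.eq_formalMultilinearSeries
    (hasFPowerSeriesOnBall_ofScalars_of_hasSum he).hasFPowerSeriesAt
  funext n
  have := congrArg (fun p => FormalMultilinearSeries.coeff p n) h
  simpa [FormalMultilinearSeries.coeff_ofScalars] using this

/-- Split the integral along the events N = m. The weight Y carries the other variable's power, so
that coefficients can be extracted one variable at a time. -/
theorem hasSum_setIntegral_mul_pow {Ω : Type*} [MeasurableSpace Ω] {μ : Measure Ω} {N : Ω → ℕ}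
    (hN : Measurable N) {Y : Ω → ℝ} (hY : Integrable Y μ) {u : ℝ} (hu : |u| ≤ 1) :
    HasSum (fun m => (∫ ω in N ⁻¹' {m}, Y ω ∂μ) * u ^ m) (∫ ω, u ^ N ω * Y ω ∂μ) := by
  have hm : ∀ m : ℕ, MeasurableSet (N ⁻¹' {m}) := fun m => hN (measurableSet_singleton m)
  have hint : Integrable (fun ω => u ^ N ω * Y ω) μ := by
    refine hY.bdd_mul (c := 1) ((Measurable.of_discrete (f := fun n : ℕ => u ^ n)).comp
      hN).aestronglyMeasurable (ae_of_all _ fun ω => ?_)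
    simpa using pow_le_one₀ (abs_nonneg u) hu
  have h := hasSum_integral_iUnion (μ := μ) (f := fun ω => u ^ N ω * Y ω) hm
    (fun i j hij => Disjoint.preimage N (by simpa using hij)) hint.integrableOn
  have huniv : ⋃ m, N ⁻¹' {m} = Set.univ := by ext; simp
  rw [huniv, setIntegral_univ] at h
  convert! h using 2 with m
  rw [mul_comm, ← integral_const_mul]
  refine setIntegral_congr_fun (hm m) fun ω hω => ?_
  simp only [Set.mem_preimage, Set.mem_singleton_iff] at hω
  simp only [hω]

/-- The coefficient of `u ^ m * v ^ n` in `exp (p * u * v + s * u + s * v)`. -/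
noncomputable def jointWeight (p s : ℝ) (m n : ℕ) : ℝ :=
  ∑ l ∈ Finset.range (min m n + 1),
    (p ^ l / (l ! : ℝ)) * (s ^ (m + n - 2 * l) / (((m - l)! : ℝ) * ((n - l)! : ℝ)))

theorem Real.hasSum_exp_mul (s v : ℝ) :
    HasSum (fun n : ℕ => s ^ n / (n ! : ℝ) * v ^ n) (Real.exp (s * v)) := by
  have h := NormedSpace.expSeries_div_hasSum_exp (s * v)
  rw [← Real.exp_eq_exp_ℝ] at h
  convert! h using 2 with n
  rw [mul_pow]
  ring

/-- The right side is the coefficient of u ^ m in exp(sv) exp((pv + s)u). Expanding (pv + s) ^ m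
binomially, the power v ^ l shifts the exponential series by l. -/
theorem hasSum_jointWeight (p s v : ℝ) (m : ℕ) :
    HasSum (fun n => jointWeight p s m n * v ^ n)
      (Real.exp (s * v) * ((p * v + s) ^ m / (m ! : ℝ))) := by
  have hl : ∀ l, HasSum (fun n => if l ≤ n then s ^ (n - l) / ((n - l)! : ℝ) * v ^ n else 0)
      (v ^ l * Real.exp (s * v)) := fun l => by
    have h := (Real.hasSum_exp_mul s v).mul_left (v ^ l)
    rw [← (add_left_injective l).hasSum_iff]
    · convert! h using 2 with n
      simp only [Function.comp_apply, le_add_iff_nonneg_left, zero_le, if_true,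
        Nat.add_sub_cancel, pow_add]
      ring
    · intro n hn
      refine if_neg fun hle => hn ⟨n - l, ?_⟩
      simp only
      omega
  have h := hasSum_sum (s := Finset.range (m + 1)) fun l _ =>
    (hl l).mul_left (p ^ l / (l ! : ℝ) * (s ^ (m - l) / ((m - l)! : ℝ)))
  convert! h using 1
  · funext n
    rw [jointWeight, Finset.sum_mul]
    -- The binomial sum runs over l ≤ m, the weight over l ≤ min m n; terms with l > n are zero.
    refine Finset.sum_subset_zero_on_sdiff (fun l hl' => ?_) (fun l hl' => ?_) fun l hlm => ?_
    · simp only [Finset.mem_range] at hl' ⊢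
      omega
    · simp only [Finset.mem_sdiff, Finset.mem_range] at hl'
      rw [if_neg (by omega), mul_zero]
    · have hlm' : l ≤ min m n := by simpa [Nat.lt_succ_iff] using hlm
      rw [if_pos (hlm'.trans (min_le_right _ _)),
        show m + n - 2 * l = (m - l) + (n - l) by omega, pow_add]
      ring
  · rw [add_pow, Finset.sum_div, Finset.mul_sum]
    refine Finset.sum_congr rfl fun l hlm => ?_
    have hlm' : l ≤ m := by simpa [Nat.lt_succ_iff] using hlm
    rw [Nat.cast_choose ℝ hlm', mul_pow]
    have h1 : (m ! : ℝ) ≠ 0 := by positivity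
    have h2 : (l ! : ℝ) ≠ 0 := by positivity
    have h3 : ((m - l)! : ℝ) ≠ 0 := by positivity
    field_simp

theorem continuous_jointWeight (m n : ℕ) : Continuous fun q : ℝ × ℝ => jointWeight q.1 q.2 m n := by
  unfold jointWeight
  fun_prop

namespace IsPoissonBoolean

variable {d : ℕ} {Ω Ω₀ : Type*} [MeasurableSpace Ω] [MeasurableSpace Ω₀]
  {X : ℕ → Ω → EuclideanSpace ℝ (Fin d)} {S : ℕ → Ω → Closeds (EuclideanSpace ℝ (Fin d))}
  {lam : ℝ} {P : Measure Ω}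
  {C : Ω₀ → Closeds (EuclideanSpace ℝ (Fin d))} {Q : Measure Ω₀}
  {τ δ : ℝ}

theorem measurable_coverCount_apply (h : IsPoissonBoolean X S lam P C Q) (hδ : 0 < δ)
    (z : EuclideanSpace ℝ (Fin d)) : Measurable (coverCount X S δ z) :=
  measurable_encard_setOf_mem
    (A := fun i => {ω | z ∈ X i ω +ᵥ δ • (S i ω : Set (EuclideanSpace ℝ (Fin d)))}) fun i =>
    measurableSet_mem_scaled_closeds hδ.ne' measurable_const (h.poisson.measurable i)
      (h.shape_measurable i)

theorem measurable_toNat_coverCount (h : IsPoissonBoolean X S lam P C Q) (hδ : 0 < δ)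
    (z : EuclideanSpace ℝ (Fin d)) : Measurable fun ω => (coverCount X S δ z ω).toNat :=
  (Measurable.of_discrete (f := ENat.toNat)).comp (h.measurable_coverCount_apply hδ z)

variable [IsProbabilityMeasure P] [IsProbabilityMeasure Q]

/-- For fixed v the exponent of the generating function is affine in u, namely a(b - 2β) + a(β - b)v
+ (abv + a(β - b))u, so its u ^ m coefficient comes from the exponential series. -/
theorem setIntegral_pow_coverCount (h : IsPoissonBoolean X S lam P C Q) (hlam : 0 ≤ lam)
    (hδ : 0 < δ) (hC : Measurable C)
    (hCτ : ∀ᵐ ω ∂Q, (C ω : Set (EuclideanSpace ℝ (Fin d))) ⊆ Metric.closedBall 0 τ)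
    (z₁ z₂ : EuclideanSpace ℝ (Fin d)) (m : ℕ) {v : ℝ} (hv : |v| ≤ 1) :
    ∫ ω in (fun ω => (coverCount X S δ z₁ ω).toNat) ⁻¹' {m}, v ^ (coverCount X S δ z₂ ω).toNat ∂P =
      Real.exp (δ ^ d * lam * (meanB1 C Q (δ⁻¹ • (z₂ - z₁)) - 2 * meanVolume C Q)) *
      (Real.exp (δ ^ d * lam * meanB2 C Q (δ⁻¹ • (z₂ - z₁)) * v) *
        ((δ ^ d * lam * meanB1 C Q (δ⁻¹ • (z₂ - z₁)) * v +
          δ ^ d * lam * meanB2 C Q (δ⁻¹ • (z₂ - z₁))) ^ m / (m ! : ℝ))) := by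
  have hY : Integrable (fun ω => v ^ (coverCount X S δ z₂ ω).toNat) P := by
    refine Integrable.of_bound ((Measurable.of_discrete (f := fun n : ℕ => v ^ n)).comp
      (h.measurable_toNat_coverCount hδ z₂)).aestronglyMeasurable 1 (ae_of_all _ fun ω => ?_)
    simpa using pow_le_one₀ (abs_nonneg v) hv
  refine congrFun (eq_of_hasSum_mul_pow
    (fun u hu => hasSum_setIntegral_mul_pow (h.measurable_toNat_coverCount hδ z₁) hY hu)
    (e := fun m => Real.exp (δ ^ d * lam * (meanB1 C Q (δ⁻¹ • (z₂ - z₁)) - 2 * meanVolume C Q)) *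
      (Real.exp (δ ^ d * lam * meanB2 C Q (δ⁻¹ • (z₂ - z₁)) * v) *
        ((δ ^ d * lam * meanB1 C Q (δ⁻¹ • (z₂ - z₁)) * v +
          δ ^ d * lam * meanB2 C Q (δ⁻¹ • (z₂ - z₁))) ^ m / (m ! : ℝ)))) fun u hu => ?_) m
  rw [h.integral_pow_coverCount_mul_pow hlam hδ hC hCτ z₁ z₂ hu hv, meanB2_eq_sub hC hCτ]
  generalize meanB1 C Q (δ⁻¹ • (z₂ - z₁)) = b
  generalize meanVolume C Q = β
  generalize δ ^ d * lam = a
  have h1 := (Real.hasSum_exp_mul (a * b * v + a * (β - b)) u).mul_left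
    (Real.exp (a * (b - 2 * β)) * Real.exp (a * (β - b) * v))
  rw [← Real.exp_add, ← Real.exp_add] at h1
  convert! h1 using 1
  · funext n
    rw [Real.exp_add]
    ring
  · congr 1
    ring

/-- The joint law of the numbers of shapes covering two points. -/
theorem measureReal_coverCount_eq_inter (h : IsPoissonBoolean X S lam P C Q) (hlam : 0 ≤ lam)
    (hδ : 0 < δ) (hC : Measurable C)
    (hCτ : ∀ᵐ ω ∂Q, (C ω : Set (EuclideanSpace ℝ (Fin d))) ⊆ Metric.closedBall 0 τ)
    (z₁ z₂ : EuclideanSpace ℝ (Fin d)) (m n : ℕ) :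
    P.real ({ω | coverCount X S δ z₁ ω = m} ∩ {ω | coverCount X S δ z₂ ω = n}) =
      Real.exp (δ ^ d * lam * (meanB1 C Q (δ⁻¹ • (z₂ - z₁)) - 2 * meanVolume C Q)) *
        jointWeight (δ ^ d * lam * meanB1 C Q (δ⁻¹ • (z₂ - z₁)))
          (δ ^ d * lam * meanB2 C Q (δ⁻¹ • (z₂ - z₁))) m n := by
  have hae : ({ω | coverCount X S δ z₁ ω = m} ∩ {ω | coverCount X S δ z₂ ω = n} : Set Ω) =ᵐ[P]
      ((fun ω => (coverCount X S δ z₂ ω).toNat) ⁻¹' {n} ∩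
        (fun ω => (coverCount X S δ z₁ ω).toNat) ⁻¹' {m} : Set Ω) := by
    rw [eventuallyEq_set]
    filter_upwards [h.ae_coverCount_ne_top hδ hCτ z₁, h.ae_coverCount_ne_top hδ hCτ z₂]
      with ω h1 h2
    simp only [Set.mem_inter_iff, Set.mem_ofPred_eq, Set.mem_preimage, Set.mem_singleton_iff]
    rw [← ENat.natCast_toNat h1, ← ENat.natCast_toNat h2]
    simp [and_comm]
  rw [measureReal_congr hae]
  have hm := h.measurable_toNat_coverCount hδ z₁
  have hn := h.measurable_toNat_coverCount hδ z₂
  -- Second extraction: with m fixed, coefficients are compared in v.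
  refine congrFun (eq_of_hasSum_mul_pow
    (c := fun n => P.real ((fun ω => (coverCount X S δ z₂ ω).toNat) ⁻¹' {n} ∩
        (fun ω => (coverCount X S δ z₁ ω).toNat) ⁻¹' {m}))
    (e := fun n => Real.exp (δ ^ d * lam * (meanB1 C Q (δ⁻¹ • (z₂ - z₁)) - 2 * meanVolume C Q)) *
        jointWeight (δ ^ d * lam * meanB1 C Q (δ⁻¹ • (z₂ - z₁)))
          (δ ^ d * lam * meanB2 C Q (δ⁻¹ • (z₂ - z₁))) m n)
    (f := fun v => ∫ ω in (fun ω => (coverCount X S δ z₁ ω).toNat) ⁻¹' {m},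
        v ^ (coverCount X S δ z₂ ω).toNat ∂P) (fun v hv => ?_) fun v hv => ?_) n
  · have h1 := hasSum_setIntegral_mul_pow
      (μ := P.restrict ((fun ω => (coverCount X S δ z₁ ω).toNat) ⁻¹' {m})) hn
      (integrable_const (1 : ℝ)) hv
    simp only [setIntegral_const, smul_eq_mul, mul_one] at h1
    simpa only [measureReal_restrict_apply (hn (measurableSet_singleton _))] using h1
  · rw [h.setIntegral_pow_coverCount hlam hδ hC hCτ z₁ z₂ m hv]
    simpa only [mul_assoc] using (hasSum_jointWeight (δ ^ d * lam * meanB1 C Q (δ⁻¹ • (z₂ - z₁)))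
      (δ ^ d * lam * meanB2 C Q (δ⁻¹ • (z₂ - z₁))) v m).mul_left
        (Real.exp (δ ^ d * lam * (meanB1 C Q (δ⁻¹ • (z₂ - z₁)) - 2 * meanVolume C Q)))

/-- The number of shapes covering a point is Poisson distributed. -/
theorem measureReal_coverCount_eq (h : IsPoissonBoolean X S lam P C Q) (hlam : 0 ≤ lam)
    (hδ : 0 < δ) (hC : Measurable C)
    (hCτ : ∀ᵐ ω ∂Q, (C ω : Set (EuclideanSpace ℝ (Fin d))) ⊆ Metric.closedBall 0 τ)
    (z : EuclideanSpace ℝ (Fin d)) (m : ℕ) :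
    P.real {ω | coverCount X S δ z ω = m} = Real.exp (-(δ ^ d * lam * meanVolume C Q)) *
      (δ ^ d * lam * meanVolume C Q) ^ m / (m ! : ℝ) := by
  have hae : ({ω | coverCount X S δ z ω = m} : Set Ω) =ᵐ[P]
      ((fun ω => (coverCount X S δ z ω).toNat) ⁻¹' {m} : Set Ω) := by
    rw [eventuallyEq_set]
    filter_upwards [h.ae_coverCount_ne_top hδ hCτ z] with ω h1
    simp only [Set.mem_preimage, Set.mem_singleton_iff]
    rw [← ENat.natCast_toNat h1]
    simp
  rw [measureReal_congr hae]
  -- At v = 1 the second point plays no role: the overlap cancels because `meanB1` and `meanB2` add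
  -- up to β.
  have h1 := h.setIntegral_pow_coverCount hlam hδ hC hCτ z z m (v := 1) (by simp)
  simp only [one_pow, setIntegral_const, smul_eq_mul, mul_one] at h1
  rw [h1, meanB2_eq_sub hC hCτ, ← mul_assoc, ← Real.exp_add, mul_div_assoc]
  congr 3 <;> ring

end IsPoissonBoolean

/-! ### Moments of integrals of bounded random fields -/

section RandomIntegral

variable {E Ω : Type*} [MeasurableSpace E] [MeasurableSpace Ω] {μ : Measure E} [IsFiniteMeasure μ]
  {P : Measure Ω} {f : E → Ω → ℝ} {K : ℝ}

theorem memLp_top_integral (hf : Measurable fun p : E × Ω => f p.1 p.2) (hK : ∀ x ω, |f x ω| ≤ K) :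
    MemLp (fun ω => ∫ x, f x ω ∂μ) ∞ P := by
  have hm : StronglyMeasurable fun ω => ∫ x, f x ω ∂μ :=
    StronglyMeasurable.integral_prod_left (f := f) hf.stronglyMeasurable
  refine memLp_top_of_bound hm.aestronglyMeasurable (K * μ.real Set.univ) (ae_of_all _ fun ω => ?_)
  exact norm_integral_le_of_norm_le_const (ae_of_all _ fun x => hK x ω)

variable [IsProbabilityMeasure P]

theorem abs_integral_le_of_abs_le {g : Ω → ℝ} (hg : ∀ ω, |g ω| ≤ K) : |∫ ω, g ω ∂P| ≤ K := by
  simpa using norm_integral_le_of_norm_le_const (μ := P) (f := g) (ae_of_all _ hg)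

theorem integral_integral_swap_of_bounded (hf : Measurable fun p : E × Ω => f p.1 p.2)
    (hK : ∀ x ω, |f x ω| ≤ K) :
    ∫ ω, (∫ x, f x ω ∂μ) ∂P = ∫ x, (∫ ω, f x ω ∂P) ∂μ :=
  (integral_integral_swap (Integrable.of_bound (f := Function.uncurry f) hf.aestronglyMeasurable K
    (ae_of_all _ fun p => hK p.1 p.2))).symm

/-- The variance of an integral of random variables is the double integral of their covariances. -/
theorem variance_integral (hf : Measurable fun p : E × Ω => f p.1 p.2) (hK : ∀ x ω, |f x ω| ≤ K) :
    Var[fun ω => ∫ x, f x ω ∂μ; P] =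
      ∫ x, (∫ x', ((∫ ω, f x ω * f x' ω ∂P) - (∫ ω, f x ω ∂P) * ∫ ω, f x' ω ∂P) ∂μ) ∂μ := by
  have hV : MemLp (fun ω => ∫ x, f x ω ∂μ) 2 P := (memLp_top_integral hf hK).mono_exponent le_top
  have hK2 : ∀ x x' ω, |f x ω * f x' ω| ≤ K * K := fun x x' ω => by
    rw [abs_mul]
    exact mul_le_mul (hK _ _) (hK _ _) (abs_nonneg _) ((abs_nonneg _).trans (hK x ω))
  have hE : Measurable fun x => ∫ ω, f x ω ∂P :=
    (StronglyMeasurable.integral_prod_right (f := f) hf.stronglyMeasurable).measurable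
  have hEK : ∀ x, |∫ ω, f x ω ∂P| ≤ K := fun x =>
    abs_integral_le_of_abs_le (hK x)
  have hff : Measurable fun p : (E × E) × Ω => f p.1.1 p.2 * f p.1.2 p.2 := by
    have h1 : Measurable fun p : (E × E) × Ω => (p.1.1, p.2) := by fun_prop
    have h2 : Measurable fun p : (E × E) × Ω => (p.1.2, p.2) := by fun_prop
    exact (hf.comp h1).mul (hf.comp h2)
  have hE2 : Measurable fun p : E × E => ∫ ω, f p.1 ω * f p.2 ω ∂P :=
    (StronglyMeasurable.integral_prod_right (f := fun (p : E × E) ω => f p.1 ω * f p.2 ω)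
      hff.stronglyMeasurable).measurable
  have hE2K : ∀ x x', |∫ ω, f x ω * f x' ω ∂P| ≤ K * K := fun x x' =>
    abs_integral_le_of_abs_le (hK2 x x')
  have hi1 : Integrable (fun p : E × E => ∫ ω, f p.1 ω * f p.2 ω ∂P) (μ.prod μ) :=
    Integrable.of_bound hE2.aestronglyMeasurable (K * K) (ae_of_all _ fun p => hE2K _ _)
  have hi2 : Integrable (fun x => ∫ ω, f x ω ∂P) μ :=
    Integrable.of_bound hE.aestronglyMeasurable K (ae_of_all _ hEK)
  have hsq : ∫ ω, (∫ x, f x ω ∂μ) ^ 2 ∂P = ∫ p, (∫ ω, f p.1 ω * f p.2 ω ∂P) ∂(μ.prod μ) := by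
    rw [← integral_integral_swap_of_bounded (f := fun (p : E × E) ω => f p.1 ω * f p.2 ω) hff
      (fun p ω => hK2 p.1 p.2 ω)]
    refine integral_congr_ae (ae_of_all _ fun ω => ?_)
    simp only
    rw [integral_prod_mul (fun x => f x ω) (fun x => f x ω), sq]
  rw [variance_eq_sub hV]
  simp only [Pi.pow_apply]
  rw [hsq, integral_integral_swap_of_bounded hf hK, sq, ← integral_prod_mul,
    ← integral_sub hi1 (hi2.mul_prod hi2)]
  exact integral_prod _ (hi1.sub (hi2.mul_prod hi2))

end RandomIntegral

theorem abs_integral_mul_sub_le {E Ω : Type*} [MeasurableSpace Ω] {P : Measure Ω}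
    [IsProbabilityMeasure P] {f : E → Ω → ℝ} {K : ℝ} (hK : ∀ x ω, |f x ω| ≤ K) (x x' : E) :
    |(∫ ω, f x ω * f x' ω ∂P) - (∫ ω, f x ω ∂P) * ∫ ω, f x' ω ∂P| ≤ 2 * K ^ 2 := by
  have hEK : ∀ x, |∫ ω, f x ω ∂P| ≤ K := fun x =>
    abs_integral_le_of_abs_le (hK x)
  have h1 : |∫ ω, f x ω * f x' ω ∂P| ≤ K * K := abs_integral_le_of_abs_le fun ω => by
    rw [abs_mul]
    exact mul_le_mul (hK _ _) (hK _ _) (abs_nonneg _) ((abs_nonneg _).trans (hK x ω))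
  have h2 : |(∫ ω, f x ω ∂P) * ∫ ω, f x' ω ∂P| ≤ K * K := by
    rw [abs_mul]
    exact mul_le_mul (hEK _) (hEK _) (abs_nonneg _) ((abs_nonneg _).trans (hEK x))
  refine (abs_sub _ _).trans ?_
  linarith

/-! ### Rescaled displacements and translates of R -/

section Translation

variable {d : ℕ}

/-- Substitute x' = x + δy, with Jacobian δ^d, and integrate first over x. Since κ lives on B, the
y-integral is over a set of finite measure, where boundedness is enough for Fubini. -/
theorem setIntegral_setIntegral_comp_smul_sub {R B : Set (EuclideanSpace ℝ (Fin d))}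
    (hR : MeasurableSet R) (hRfin : volume R ≠ ∞) (hBfin : volume B ≠ ∞)
    {κ : EuclideanSpace ℝ (Fin d) → ℝ} (hκ : Measurable κ) {K : ℝ} (hκK : ∀ y, |κ y| ≤ K)
    (hκB : ∀ y ∉ B, κ y = 0) {δ : ℝ} (hδ : 0 < δ) :
    ∫ x in R, (∫ x' in R, κ (δ⁻¹ • (x' - x))) =
      δ ^ d * ∫ y in B, κ y * volume.real (R ∩ (fun x => x + δ • y) ⁻¹' R) := by
  have hfinR : IsFiniteMeasure (volume.restrict R) := ⟨by simpa using hRfin.lt_top⟩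
  have hfinB : IsFiniteMeasure (volume.restrict B) := ⟨by simpa using hBfin.lt_top⟩
  have hinner : ∀ x : EuclideanSpace ℝ (Fin d), ∫ x' in R, κ (δ⁻¹ • (x' - x)) =
      δ ^ d * ∫ y in B, κ y * R.indicator 1 (x + δ • y) := fun x => by
    -- Writing z as δ • (δ⁻¹ • z) exhibits the integrand as a function of δ⁻¹ • z, ready for the
    -- scaling formula.
    have h1 : ∫ x' in R, κ (δ⁻¹ • (x' - x)) =
        ∫ z, κ (δ⁻¹ • z) * R.indicator 1 (x + δ • (δ⁻¹ • z)) := by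
      rw [← integral_indicator hR, ← integral_add_left_eq_self _ x]
      refine integral_congr_ae (ae_of_all _ fun z => ?_)
      simp only [smul_inv_smul₀ hδ.ne']
      by_cases hz : x + z ∈ R <;> simp [hz]
    rw [h1, Measure.integral_comp_smul volume (fun y => κ y * R.indicator 1 (x + δ • y)) δ⁻¹,
      finrank_euclideanSpace_fin, inv_pow, inv_inv, abs_of_pos (by positivity), smul_eq_mul,
      setIntegral_eq_integral_of_forall_compl_eq_zero]
    intro y hy
    rw [hκB y hy, zero_mul]
  simp_rw [hinner]
  rw [integral_const_mul]
  congr 1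
  have hm : Measurable fun p : EuclideanSpace ℝ (Fin d) × EuclideanSpace ℝ (Fin d) =>
      R.indicator (1 : EuclideanSpace ℝ (Fin d) → ℝ) (p.1 + δ • p.2) :=
    (measurable_one.indicator hR).comp (by fun_prop)
  have hbd : ∀ z, |R.indicator (1 : EuclideanSpace ℝ (Fin d) → ℝ) z| ≤ 1 := fun z => by
    by_cases hz : z ∈ R <;> simp [hz]
  rw [integral_integral_swap (f := fun x y => κ y * R.indicator 1 (x + δ • y))]
  · refine integral_congr_ae (ae_of_all _ fun y => ?_)
    simp only
    have hp : MeasurableSet ((fun x => x + δ • y) ⁻¹' R) := (by fun_prop : Measurable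
      fun x : EuclideanSpace ℝ (Fin d) => x + δ • y) hR
    have hind : ∫ x in R, R.indicator (1 : EuclideanSpace ℝ (Fin d) → ℝ) (x + δ • y) =
        ∫ x in R, ((fun x => x + δ • y) ⁻¹' R).indicator 1 x := rfl
    rw [integral_const_mul, hind, integral_indicator_one hp, measureReal_restrict_apply hp,
      Set.inter_comm]
  · refine Integrable.of_bound ((hκ.comp measurable_snd).mul hm).aestronglyMeasurable (K * 1)
      (ae_of_all _ fun p => ?_)
    simp only [Function.uncurry, norm_mul]
    exact mul_le_mul (hκK _) (hbd _) (abs_nonneg _) ((abs_nonneg _).trans (hκK p.2))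

/-- Squeeze between ‖R‖ - ‖(R - δy) ∆ R‖ and ‖R‖: the symmetric difference vanishes in the limit for
measure preserving maps converging in the compact-open topology. -/
theorem tendsto_volumeReal_inter_preimage_add_smul {R : Set (EuclideanSpace ℝ (Fin d))}
    (hR : MeasurableSet R) (hRfin : volume R ≠ ∞) (y : EuclideanSpace ℝ (Fin d))
    {ι : Type*} {l : Filter ι} {δ : ι → ℝ} (hδ : Tendsto δ l (𝓝 0)) :
    Tendsto (fun i => volume.real (R ∩ (fun x => x + δ i • y) ⁻¹' R)) l (𝓝 (volume.real R)) := by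
  let F : ℝ → C(EuclideanSpace ℝ (Fin d), EuclideanSpace ℝ (Fin d)) := fun c =>
    ⟨fun x => x + c • y, by fun_prop⟩
  have hF : Continuous F := ContinuousMap.continuous_of_continuous_uncurry _ (by
    show Continuous fun p : ℝ × EuclideanSpace ℝ (Fin d) => p.2 + p.1 • y
    fun_prop)
  have hmp : ∀ c, MeasurePreserving (F c) volume volume := fun c =>
    measurePreserving_add_right volume (c • y)
  have h := tendsto_measure_symmDiff_preimage_nhds_zero ((hF.tendsto 0).comp hδ)
    (Eventually.of_forall fun i => hmp (δ i)) (hmp 0) hR.nullMeasurableSet hRfin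
  have h0 : (F 0 : EuclideanSpace ℝ (Fin d) → EuclideanSpace ℝ (Fin d)) ⁻¹' R = R := by
    ext x
    simp [F]
  rw [h0] at h
  have h' := (ENNReal.tendsto_toReal ENNReal.zero_ne_top).comp h
  rw [ENNReal.toReal_zero] at h'
  have hlow : Tendsto (fun i => volume.real R - volume.real (symmDiff (F (δ i) ⁻¹' R) R)) l
      (𝓝 (volume.real R)) := by
    simpa [measureReal_def] using h'.const_sub (volume.real R)
  refine tendsto_of_tendsto_of_tendsto_of_le_of_le hlow tendsto_const_nhds (fun i => ?_)
    fun i => measureReal_mono Set.inter_subset_left hRfin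
  have hp : MeasurableSet (F (δ i) ⁻¹' R) := (F (δ i)).continuous.measurable hR
  have hpfin : volume (F (δ i) ⁻¹' R) ≠ ∞ := by
    rw [(hmp (δ i)).measure_preimage hR.nullMeasurableSet]
    exact hRfin
  have h1 := measureReal_inter_add_sdiff (μ := volume) (s := R) hp hRfin
  have h2 : volume.real (R \ F (δ i) ⁻¹' R) ≤ volume.real (symmDiff (F (δ i) ⁻¹' R) R) :=
    measureReal_mono Set.subset_union_right
      (ne_top_of_le_ne_top (ENNReal.add_ne_top.2 ⟨hpfin, hRfin⟩)
        ((measure_mono (Set.symmDiff_subset_union)).trans (measure_union_le _ _)))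
  have h3 : volume.real (R ∩ (fun x => x + δ i • y) ⁻¹' R) = volume.real (R ∩ F (δ i) ⁻¹' R) := rfl
  simp only
  rw [h3]
  linarith

end Translation

/-! ### The covariance kernel -/

/-- The limit of the covariance of the indicators that two points at relative displacement `δ • y`
are covered fewer than `k` times, where `δ ^ d * lam = a`. -/
noncomputable def covKernel {d : ℕ} {Ω₀ : Type*} [MeasurableSpace Ω₀]
    (C : Ω₀ → Closeds (EuclideanSpace ℝ (Fin d))) (Q : Measure Ω₀) (k : ℕ) (a : ℝ)
    (y : EuclideanSpace ℝ (Fin d)) : ℝ :=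
  Real.exp (-2 * a * meanVolume C Q) * ∑ m ∈ Finset.range k, ∑ n ∈ Finset.range k,
    (Real.exp (a * meanB1 C Q y) * jointWeight (a * meanB1 C Q y) (a * meanB2 C Q y) m n -
      (a * meanVolume C Q) ^ (m + n) / ((m ! : ℝ) * (n ! : ℝ)))

/-- Without overlap the weights factor: counts at points that no single set can cover together are
independent. This is why the kernel vanishes beyond 2τ. -/
theorem jointWeight_zero (s : ℝ) (m n : ℕ) :
    jointWeight 0 s m n = s ^ (m + n) / ((m ! : ℝ) * (n ! : ℝ)) := by
  rw [jointWeight, Finset.sum_eq_single 0]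
  · simp
  · intro l _ hl
    simp [hl]
  · simp

section Kernel

variable {d : ℕ} {Ω₀ : Type*} [MeasurableSpace Ω₀] {Q : Measure Ω₀}
  {C : Ω₀ → Closeds (EuclideanSpace ℝ (Fin d))} {τ : ℝ}

theorem continuous_covKernel (k : ℕ) (y : EuclideanSpace ℝ (Fin d)) :
    Continuous fun a => covKernel C Q k a y := by
  have h : ∀ m n, Continuous fun a : ℝ =>
      jointWeight (a * meanB1 C Q y) (a * meanB2 C Q y) m n := fun m n =>
    (continuous_jointWeight m n).comp (f := fun a : ℝ => (a * meanB1 C Q y, a * meanB2 C Q y))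
      (by fun_prop)
  unfold covKernel
  fun_prop

variable [IsProbabilityMeasure Q]

theorem measurable_meanB2 (hC : Measurable C)
    (hCτ : ∀ᵐ ω ∂Q, (C ω : Set (EuclideanSpace ℝ (Fin d))) ⊆ Metric.closedBall 0 τ) :
    Measurable (meanB2 C Q) := by
  rw [show meanB2 C Q = fun y => meanVolume C Q - meanB1 C Q y from
    funext fun y => meanB2_eq_sub hC hCτ y]
  exact measurable_const.sub (measurable_meanB1 hC)

theorem measurable_covTerm (hC : Measurable C)
    (hCτ : ∀ᵐ ω ∂Q, (C ω : Set (EuclideanSpace ℝ (Fin d))) ⊆ Metric.closedBall 0 τ)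
    (a : ℝ) (m n : ℕ) : Measurable fun y =>
      Real.exp (a * meanB1 C Q y) * jointWeight (a * meanB1 C Q y) (a * meanB2 C Q y) m n -
      (a * meanVolume C Q) ^ (m + n) / ((m ! : ℝ) * (n ! : ℝ)) := by
  have h1 := (measurable_meanB1 (Q := Q) hC).const_mul a
  have h2 := (measurable_meanB2 hC hCτ).const_mul a
  exact ((Real.measurable_exp.comp h1).mul
    ((continuous_jointWeight m n).measurable.comp (h1.prodMk h2))).sub_const _

theorem measurable_covKernel (hC : Measurable C)
    (hCτ : ∀ᵐ ω ∂Q, (C ω : Set (EuclideanSpace ℝ (Fin d))) ⊆ Metric.closedBall 0 τ)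
    (k : ℕ) (a : ℝ) : Measurable (covKernel C Q k a) :=
  (Finset.measurable_fun_sum _ fun m _ => Finset.measurable_fun_sum _ fun n _ =>
    measurable_covTerm hC hCτ a m n).const_mul _

theorem covKernel_eq_zero (hC : Measurable C)
    (hCτ : ∀ᵐ ω ∂Q, (C ω : Set (EuclideanSpace ℝ (Fin d))) ⊆ Metric.closedBall 0 τ)
    (k : ℕ) (a : ℝ) {y : EuclideanSpace ℝ (Fin d)}
    (hy : y ∉ Metric.closedBall (0 : EuclideanSpace ℝ (Fin d)) (2 * τ)) : covKernel C Q k a y = 0 := by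
  rw [covKernel, meanB2_eq_sub hC hCτ, meanB1_eq_zero hCτ hy]
  simp [jointWeight_zero]

/-- The term is a continuous function of b = `meanB1`, which stays in the compact interval [0, β].
The bound gives integrability of each summand of σ². -/
theorem exists_abs_covTerm_le (hC : Measurable C)
    (hCτ : ∀ᵐ ω ∂Q, (C ω : Set (EuclideanSpace ℝ (Fin d))) ⊆ Metric.closedBall 0 τ)
    (a : ℝ) (m n : ℕ) : ∃ K, ∀ y,
      |Real.exp (a * meanB1 C Q y) * jointWeight (a * meanB1 C Q y) (a * meanB2 C Q y) m n -
      (a * meanVolume C Q) ^ (m + n) / ((m ! : ℝ) * (n ! : ℝ))| ≤ K := by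
  have hcont : Continuous fun b : ℝ => Real.exp (a * b) *
      jointWeight (a * b) (a * (meanVolume C Q - b)) m n -
      (a * meanVolume C Q) ^ (m + n) / ((m ! : ℝ) * (n ! : ℝ)) := by
    have h := (continuous_jointWeight m n).comp
      (f := fun b : ℝ => (a * b, a * (meanVolume C Q - b))) (by fun_prop)
    simp only [Function.comp_def] at h
    fun_prop
  obtain ⟨K, hK⟩ := (isCompact_Icc (a := (0 : ℝ)) (b := meanVolume C Q)).exists_bound_of_continuousOn
    hcont.continuousOn
  refine ⟨K, fun y => ?_⟩
  rw [meanB2_eq_sub hC hCτ]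
  exact hK _ ⟨meanB1_nonneg y, meanB1_le_meanVolume hC hCτ y⟩

theorem sigmaSq_eq (hC : Measurable C)
    (hCτ : ∀ᵐ ω ∂Q, (C ω : Set (EuclideanSpace ℝ (Fin d))) ⊆ Metric.closedBall 0 τ)
    (ρ : ℝ) (R : Set (EuclideanSpace ℝ (Fin d))) (k : ℕ) :
    sigmaSq C Q τ ρ R k = ρ * ∫ y in Metric.closedBall (0 : EuclideanSpace ℝ (Fin d)) (2 * τ),
      covKernel C Q k ρ y * volume.real R := by
  have hfin : IsFiniteMeasure (volume.restrict
      (Metric.closedBall (0 : EuclideanSpace ℝ (Fin d)) (2 * τ))) :=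
    ⟨by simpa using measure_closedBall_lt_top⟩
  have hint : ∀ m n, Integrable (fun y =>
      Real.exp (ρ * meanB1 C Q y) * jointWeight (ρ * meanB1 C Q y) (ρ * meanB2 C Q y) m n -
      (ρ * meanVolume C Q) ^ (m + n) / ((m ! : ℝ) * (n ! : ℝ))) (volume.restrict
      (Metric.closedBall (0 : EuclideanSpace ℝ (Fin d)) (2 * τ))) := fun m n => by
    obtain ⟨K, hK⟩ := exists_abs_covTerm_le hC hCτ ρ m n
    exact Integrable.of_bound (measurable_covTerm hC hCτ ρ m n).aestronglyMeasurable K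
      (ae_of_all _ hK)
  simp only [covKernel]
  rw [integral_mul_const, integral_const_mul,
    integral_finsetSum _ fun m _ => integrable_finsetSum _ fun n _ => hint m n]
  simp_rw [integral_finsetSum _ fun n (_ : n ∈ Finset.range k) => hint _ n]
  simp only [sigmaSq, jointWeight]
  ring

end Kernel

/-! ### Exact mean and variance of the vacancy -/

theorem abs_coverIndicator_le_one {d : ℕ} {Ω : Type*} (X : ℕ → Ω → EuclideanSpace ℝ (Fin d))
    (S : ℕ → Ω → Closeds (EuclideanSpace ℝ (Fin d))) (δ : ℝ) (m : ℕ)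
    (x : EuclideanSpace ℝ (Fin d)) (ω : Ω) : |coverIndicator X S δ m x ω| ≤ 1 := by
  unfold coverIndicator
  split_ifs <;> simp

theorem coverIndicator_eq_indicator {d : ℕ} {Ω : Type*} (X : ℕ → Ω → EuclideanSpace ℝ (Fin d))
    (S : ℕ → Ω → Closeds (EuclideanSpace ℝ (Fin d))) (δ : ℝ) (m : ℕ)
    (x : EuclideanSpace ℝ (Fin d)) :
    coverIndicator X S δ m x = {ω | coverCount X S δ x ω = m}.indicator 1 := by
  classical
  funext ω
  simp [coverIndicator, Set.indicator_apply]

/-- The bound k is crude, the events being disjoint; all that matters is that it is uniform in λ and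
δ. -/
theorem abs_sum_coverIndicator_le {d : ℕ} {Ω : Type*}
    (X : ℕ → Ω → EuclideanSpace ℝ (Fin d)) (S : ℕ → Ω → Closeds (EuclideanSpace ℝ (Fin d))) (δ : ℝ)
    (k : ℕ) (x : EuclideanSpace ℝ (Fin d)) (ω : Ω) :
    |∑ m ∈ Finset.range k, coverIndicator X S δ m x ω| ≤ k := by
  refine (Finset.abs_sum_le_sum_abs _ _).trans ?_
  refine (Finset.sum_le_sum fun m _ => abs_coverIndicator_le_one X S δ m x ω).trans ?_
  simp

namespace IsPoissonBoolean

variable {d : ℕ} {Ω Ω₀ : Type*} [MeasurableSpace Ω] [MeasurableSpace Ω₀]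
  {X : ℕ → Ω → EuclideanSpace ℝ (Fin d)} {S : ℕ → Ω → Closeds (EuclideanSpace ℝ (Fin d))}
  {lam : ℝ} {P : Measure Ω} {C : Ω₀ → Closeds (EuclideanSpace ℝ (Fin d))} {Q : Measure Ω₀}
  {τ δ : ℝ} {R : Set (EuclideanSpace ℝ (Fin d))}

theorem measurable_coverIndicator (h : IsPoissonBoolean X S lam P C Q) (hδ : 0 < δ) (m : ℕ) :
    Measurable fun p : EuclideanSpace ℝ (Fin d) × Ω => coverIndicator X S δ m p.1 p.2 := by
  classical
  have hset : MeasurableSet {p : EuclideanSpace ℝ (Fin d) × Ω | coverCount X S δ p.1 p.2 = m} :=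
    measurable_coverCount hδ.ne' h.poisson.measurable h.shape_measurable (measurableSet_singleton _)
  have heq : (fun p : EuclideanSpace ℝ (Fin d) × Ω => coverIndicator X S δ m p.1 p.2) =
      {p : EuclideanSpace ℝ (Fin d) × Ω | coverCount X S δ p.1 p.2 = m}.indicator 1 := by
    funext p
    simp [coverIndicator, Set.indicator_apply]
  rw [heq]
  exact measurable_one.indicator hset

theorem measurable_sum_coverIndicator (h : IsPoissonBoolean X S lam P C Q) (hδ : 0 < δ) (k : ℕ) :
    Measurable fun p : EuclideanSpace ℝ (Fin d) × Ω =>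
      ∑ m ∈ Finset.range k, coverIndicator X S δ m p.1 p.2 :=
  Finset.measurable_fun_sum _ fun m _ => h.measurable_coverIndicator hδ m

theorem kVacancy_eq_integral (h : IsPoissonBoolean X S lam P C Q) (hδ : 0 < δ)
    (hRfin : volume R ≠ ∞) (k : ℕ) :
    kVacancy X S δ R k = fun ω => ∫ x in R, ∑ m ∈ Finset.range k, coverIndicator X S δ m x ω := by
  have hfin : IsFiniteMeasure (volume.restrict R) := ⟨by simpa using hRfin.lt_top⟩
  funext ω
  rw [kVacancy, integral_finsetSum]
  intro m _
  exact Integrable.of_bound ((h.measurable_coverIndicator hδ m).comp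
    measurable_prodMk_right).aestronglyMeasurable 1
      (ae_of_all _ fun x => abs_coverIndicator_le_one X S δ m x ω)

theorem memLp_kVacancy (h : IsPoissonBoolean X S lam P C Q) (hδ : 0 < δ)
    (hRfin : volume R ≠ ∞) (k : ℕ) : MemLp (kVacancy X S δ R k) ∞ P := by
  have hfin : IsFiniteMeasure (volume.restrict R) := ⟨by simpa using hRfin.lt_top⟩
  rw [h.kVacancy_eq_integral hδ hRfin]
  exact memLp_top_integral (h.measurable_sum_coverIndicator hδ k) (abs_sum_coverIndicator_le X S δ k)

theorem measurableSet_coverCount_eq (h : IsPoissonBoolean X S lam P C Q) (hδ : 0 < δ)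
    (x : EuclideanSpace ℝ (Fin d)) (m : ℕ) : MeasurableSet {ω | coverCount X S δ x ω = m} :=
  h.measurable_coverCount_apply hδ x (measurableSet_singleton _)

theorem abs_kVacancy_le (h : IsPoissonBoolean X S lam P C Q) (hδ : 0 < δ)
    (hRfin : volume R ≠ ∞) (k : ℕ) (ω : Ω) : |kVacancy X S δ R k ω| ≤ k * volume.real R := by
  rw [h.kVacancy_eq_integral hδ hRfin]
  exact norm_setIntegral_le_of_norm_le_const
    (f := fun x => ∑ m ∈ Finset.range k, coverIndicator X S δ m x ω) hRfin.lt_top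
    fun x _ => abs_sum_coverIndicator_le X S δ k x ω

variable [IsProbabilityMeasure P]

theorem integral_sum_coverIndicator (h : IsPoissonBoolean X S lam P C Q) (hδ : 0 < δ) (k : ℕ)
    (x : EuclideanSpace ℝ (Fin d)) :
    ∫ ω, ∑ m ∈ Finset.range k, coverIndicator X S δ m x ω ∂P =
      ∑ m ∈ Finset.range k, P.real {ω | coverCount X S δ x ω = m} := by
  simp_rw [coverIndicator_eq_indicator]
  rw [integral_finsetSum]
  · exact Finset.sum_congr rfl fun m _ =>
      integral_indicator_one (h.measurableSet_coverCount_eq hδ x m)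
  · exact fun m _ => (integrable_const (1 : ℝ)).indicator (h.measurableSet_coverCount_eq hδ x m)

theorem integral_sum_coverIndicator_mul (h : IsPoissonBoolean X S lam P C Q) (hδ : 0 < δ) (k : ℕ)
    (x x' : EuclideanSpace ℝ (Fin d)) :
    ∫ ω, (∑ m ∈ Finset.range k, coverIndicator X S δ m x ω) *
        ∑ m ∈ Finset.range k, coverIndicator X S δ m x' ω ∂P =
      ∑ m ∈ Finset.range k, ∑ n ∈ Finset.range k,
        P.real ({ω | coverCount X S δ x ω = m} ∩ {ω | coverCount X S δ x' ω = n}) := by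
  have hmeas : ∀ m n : ℕ, MeasurableSet
      ({ω | coverCount X S δ x ω = m} ∩ {ω | coverCount X S δ x' ω = n}) := fun m n =>
    (h.measurableSet_coverCount_eq hδ x m).inter (h.measurableSet_coverCount_eq hδ x' n)
  have hprod : ∀ (m n : ℕ) ω, coverIndicator X S δ m x ω * coverIndicator X S δ n x' ω =
      ({ω | coverCount X S δ x ω = m} ∩ {ω | coverCount X S δ x' ω = n}).indicator 1 ω :=
    fun m n ω => by
      rw [Set.inter_indicator_one, coverIndicator_eq_indicator, coverIndicator_eq_indicator]
      rfl
  have hi : ∀ m n : ℕ, Integrable (fun ω =>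
      ({ω | coverCount X S δ x ω = m} ∩ {ω | coverCount X S δ x' ω = n}).indicator
        (1 : Ω → ℝ) ω) P := fun m n => (integrable_const (1 : ℝ)).indicator (hmeas m n)
  simp_rw [Finset.sum_mul_sum, hprod]
  rw [integral_finsetSum _ fun m _ => integrable_finsetSum _ fun n _ => hi m n]
  refine Finset.sum_congr rfl fun m _ => ?_
  rw [integral_finsetSum _ fun n _ => hi m n]
  exact Finset.sum_congr rfl fun n _ => integral_indicator_one (hmeas m n)

variable [IsProbabilityMeasure Q]

theorem integral_kVacancy (h : IsPoissonBoolean X S lam P C Q) (hlam : 0 ≤ lam) (hδ : 0 < δ)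
    (hC : Measurable C)
    (hCτ : ∀ᵐ ω ∂Q, (C ω : Set (EuclideanSpace ℝ (Fin d))) ⊆ Metric.closedBall 0 τ)
    (hRfin : volume R ≠ ∞) (k : ℕ) :
    ∫ ω, kVacancy X S δ R k ω ∂P = volume.real R * ∑ m ∈ Finset.range k,
      Real.exp (-(δ ^ d * lam * meanVolume C Q)) * (δ ^ d * lam * meanVolume C Q) ^ m / (m ! : ℝ) := by
  have hfin : IsFiniteMeasure (volume.restrict R) := ⟨by simpa using hRfin.lt_top⟩
  rw [h.kVacancy_eq_integral hδ hRfin, integral_integral_swap_of_bounded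
    (h.measurable_sum_coverIndicator hδ k) (abs_sum_coverIndicator_le X S δ k)]
  simp_rw [h.integral_sum_coverIndicator hδ k, h.measureReal_coverCount_eq hlam hδ hC hCτ]
  rw [setIntegral_const, smul_eq_mul]

/-- An identity at every λ, not only asymptotically: λ and δ enter through δ^d λ and the rescaled
displacement alone. -/
theorem covariance_eq_covKernel (h : IsPoissonBoolean X S lam P C Q) (hlam : 0 ≤ lam) (hδ : 0 < δ)
    (hC : Measurable C)
    (hCτ : ∀ᵐ ω ∂Q, (C ω : Set (EuclideanSpace ℝ (Fin d))) ⊆ Metric.closedBall 0 τ)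
    (k : ℕ) (x x' : EuclideanSpace ℝ (Fin d)) :
    (∫ ω, (∑ m ∈ Finset.range k, coverIndicator X S δ m x ω) *
        ∑ m ∈ Finset.range k, coverIndicator X S δ m x' ω ∂P) -
      (∫ ω, ∑ m ∈ Finset.range k, coverIndicator X S δ m x ω ∂P) *
        ∫ ω, ∑ m ∈ Finset.range k, coverIndicator X S δ m x' ω ∂P =
      covKernel C Q k (δ ^ d * lam) (δ⁻¹ • (x' - x)) := by
  rw [h.integral_sum_coverIndicator_mul hδ, h.integral_sum_coverIndicator hδ,
    h.integral_sum_coverIndicator hδ, Finset.sum_mul_sum, covKernel, ← Finset.sum_sub_distrib,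
    Finset.mul_sum]
  refine Finset.sum_congr rfl fun m _ => ?_
  rw [← Finset.sum_sub_distrib, Finset.mul_sum]
  refine Finset.sum_congr rfl fun n _ => ?_
  rw [h.measureReal_coverCount_eq_inter hlam hδ hC hCτ, h.measureReal_coverCount_eq hlam hδ hC hCτ,
    h.measureReal_coverCount_eq hlam hδ hC hCτ]
  have h1 : Real.exp (δ ^ d * lam * (meanB1 C Q (δ⁻¹ • (x' - x)) - 2 * meanVolume C Q)) =
      Real.exp (-2 * (δ ^ d * lam) * meanVolume C Q) *
        Real.exp (δ ^ d * lam * meanB1 C Q (δ⁻¹ • (x' - x))) := by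
    rw [← Real.exp_add]
    congr 1
    ring
  have h2 : Real.exp (-2 * (δ ^ d * lam) * meanVolume C Q) =
      Real.exp (-(δ ^ d * lam * meanVolume C Q)) * Real.exp (-(δ ^ d * lam * meanVolume C Q)) := by
    rw [← Real.exp_add]
    congr 1
    ring
  rw [h1, h2, pow_add]
  have hm : (m ! : ℝ) ≠ 0 := by positivity
  have hn : (n ! : ℝ) ≠ 0 := by positivity
  field_simp

/-- Every value of the kernel is a covariance, for the points 0 and δy, so it inherits a bound free
of λ, δ and y without any estimate of the formula. -/
theorem abs_covKernel_le (h : IsPoissonBoolean X S lam P C Q) (hlam : 0 ≤ lam) (hδ : 0 < δ)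
    (hC : Measurable C)
    (hCτ : ∀ᵐ ω ∂Q, (C ω : Set (EuclideanSpace ℝ (Fin d))) ⊆ Metric.closedBall 0 τ)
    (k : ℕ) (y : EuclideanSpace ℝ (Fin d)) :
    |covKernel C Q k (δ ^ d * lam) y| ≤ 2 * (k : ℝ) ^ 2 := by
  have h1 := h.covariance_eq_covKernel hlam hδ hC hCτ k 0 (δ • y)
  rw [sub_zero, inv_smul_smul₀ hδ.ne'] at h1
  rw [← h1]
  exact abs_integral_mul_sub_le (f := fun x ω => ∑ m ∈ Finset.range k, coverIndicator X S δ m x ω)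
    (abs_sum_coverIndicator_le X S δ k) 0 (δ • y)

theorem variance_kVacancy (h : IsPoissonBoolean X S lam P C Q) (hlam : 0 ≤ lam) (hδ : 0 < δ)
    (hC : Measurable C)
    (hCτ : ∀ᵐ ω ∂Q, (C ω : Set (EuclideanSpace ℝ (Fin d))) ⊆ Metric.closedBall 0 τ)
    (hR : MeasurableSet R) (hRfin : volume R ≠ ∞) (k : ℕ) :
    Var[kVacancy X S δ R k; P] =
      δ ^ d * ∫ y in Metric.closedBall (0 : EuclideanSpace ℝ (Fin d)) (2 * τ),
        covKernel C Q k (δ ^ d * lam) y * volume.real (R ∩ (fun x => x + δ • y) ⁻¹' R) := by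
  have hfin : IsFiniteMeasure (volume.restrict R) := ⟨by simpa using hRfin.lt_top⟩
  rw [h.kVacancy_eq_integral hδ hRfin, variance_integral (h.measurable_sum_coverIndicator hδ k)
    (abs_sum_coverIndicator_le X S δ k)]
  simp_rw [h.covariance_eq_covKernel hlam hδ hC hCτ k]
  exact setIntegral_setIntegral_comp_smul_sub hR hRfin measure_closedBall_lt_top.ne
    (measurable_covKernel hC hCτ k _) (h.abs_covKernel_le hlam hδ hC hCτ k)
    (fun y hy => covKernel_eq_zero hC hCτ k _ hy) hδ

end IsPoissonBoolean

/-! ### Passage to the limit -/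

/-- Absolute central moments of a bounded random variable are controlled by its variance. -/
theorem integral_abs_sub_rpow_le_sqrt_variance {Ω : Type*} [MeasurableSpace Ω] {P : Measure Ω}
    [IsProbabilityMeasure P] {V : Ω → ℝ} (hV : MemLp V ∞ P) {M : ℝ} (hM : ∀ ω, |V ω| ≤ M)
    {p : ℝ} (hp : 1 ≤ p) :
    ∫ ω, |V ω - ∫ ω', V ω' ∂P| ^ p ∂P ≤ (2 * M) ^ (p - 1) * Real.sqrt (Var[V; P]) := by
  set e := ∫ ω', V ω' ∂P with he
  have heM : |e| ≤ M := abs_integral_le_of_abs_le hM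
  have hY : MemLp (fun ω => |V ω - e|) 2 P :=
    ((hV.mono_exponent le_top).sub (memLp_const e)).abs
  have hY1 : Integrable (fun ω => |V ω - e|) P := hY.integrable (by norm_num)
  have hle : ∀ ω, |V ω - e| ≤ 2 * M := fun ω => by
    have h1 := abs_sub (V ω) e
    have h2 := hM ω
    linarith
  have hsq : (∫ ω, |V ω - e| ∂P) ^ 2 ≤ Var[V; P] := by
    -- Nonnegativity of the variance of |V - e| is the inequality (E|V - e|)² ≤ E|V - e|².
    have h1 := variance_nonneg (fun ω => |V ω - e|) P
    rw [variance_eq_sub hY] at h1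
    rw [variance_eq_integral hV.aemeasurable, ← he]
    simpa using h1
  have hpow : ∀ ω, |V ω - e| ^ p ≤ (2 * M) ^ (p - 1) * |V ω - e| := fun ω => by
    have h1 := Real.rpow_add_one' (abs_nonneg (V ω - e)) (y := p - 1) (by linarith)
    rw [sub_add_cancel] at h1
    rw [h1]
    exact mul_le_mul_of_nonneg_right (Real.rpow_le_rpow (abs_nonneg _) (hle ω) (by linarith))
      (abs_nonneg _)
  have h0 : 0 ≤ 2 * M := (abs_nonneg _).trans (hle (Classical.choice P.nonempty_of_neZero))
  calc ∫ ω, |V ω - e| ^ p ∂P ≤ ∫ ω, (2 * M) ^ (p - 1) * |V ω - e| ∂P :=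
        integral_mono_of_nonneg (ae_of_all _ fun ω => Real.rpow_nonneg (abs_nonneg _) _)
          (hY1.const_mul _) (ae_of_all _ hpow)
    _ = (2 * M) ^ (p - 1) * ∫ ω, |V ω - e| ∂P := integral_const_mul _ _
    _ ≤ _ := mul_le_mul_of_nonneg_left (Real.le_sqrt_of_sq_le hsq) (Real.rpow_nonneg h0 _)

theorem theorem2 {d : ℕ} (k : ℕ) (hk : 0 < k)
    (R : Set (EuclideanSpace ℝ (Fin d))) (hR : MeasurableSet R) (hRfin : volume R ≠ ∞)
    -- the generic shape `C`
    {Ω₀ : Type*} [MeasurableSpace Ω₀] (Q : Measure Ω₀) [IsProbabilityMeasure Q]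
    (C : Ω₀ → Closeds (EuclideanSpace ℝ (Fin d))) (hC : Measurable C)
    (τ : ℝ) (hτ : 0 < τ)
    (hCτ : ∀ᵐ ω ∂Q, (C ω : Set (EuclideanSpace ℝ (Fin d))) ⊆ Metric.closedBall 0 τ)
    (hCpos : ∀ᵐ ω ∂Q, 0 < volume (C ω : Set (EuclideanSpace ℝ (Fin d))))
    -- for every intensity `lam > 0`, a Poisson-Boolean model on its own probability space
    {Ω : ℝ → Type*} [∀ lam, MeasurableSpace (Ω lam)] (P : ∀ lam, Measure (Ω lam))
    [∀ lam, IsProbabilityMeasure (P lam)]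
    (X : ∀ lam, ℕ → Ω lam → EuclideanSpace ℝ (Fin d))
    (S : ∀ lam, ℕ → Ω lam → Closeds (EuclideanSpace ℝ (Fin d)))
    (hmodel : ∀ lam, 0 < lam → IsPoissonBoolean (X lam) (S lam) lam (P lam) C Q)
    -- the scaling
    (δ : ℝ → ℝ) (hδpos : ∀ lam, 0 < lam → 0 < δ lam) (hδ : Tendsto δ atTop (𝓝 0))
    (ρ : ℝ) (hρ : 0 ≤ ρ) (hδρ : Tendsto (fun lam => δ lam ^ d * lam) atTop (𝓝 ρ)) :
    -- the vacancy is a bounded random variable, so the moments below are genuine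
    (∀ lam, 0 < lam → MemLp (kVacancy (X lam) (S lam) (δ lam) R k) ∞ (P lam)) ∧
    Tendsto (fun lam => ∫ ω, kVacancy (X lam) (S lam) (δ lam) R k ω ∂(P lam)) atTop
      (𝓝 (volume.real R * ∑ m ∈ Finset.range k,
        Real.exp (-(ρ * meanVolume C Q)) * (ρ * meanVolume C Q) ^ m / (m ! : ℝ))) ∧
    (∀ p : ℝ, 1 ≤ p →
      Tendsto (fun lam => ∫ ω, |kVacancy (X lam) (S lam) (δ lam) R k ω -
          ∫ ω', kVacancy (X lam) (S lam) (δ lam) R k ω' ∂(P lam)| ^ p ∂(P lam))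
        atTop (𝓝 0)) ∧
    Tendsto (fun lam => lam * Var[kVacancy (X lam) (S lam) (δ lam) R k; P lam]) atTop
      (𝓝 (sigmaSq C Q τ ρ R k)) := by
  have hβ : Tendsto (fun lam => δ lam ^ d * lam * meanVolume C Q) atTop
      (𝓝 (ρ * meanVolume C Q)) := hδρ.mul_const _
  have hvar : Tendsto (fun lam => lam * Var[kVacancy (X lam) (S lam) (δ lam) R k; P lam]) atTop
      (𝓝 (sigmaSq C Q τ ρ R k)) := by
    have hfin : IsFiniteMeasure (volume.restrict
        (Metric.closedBall (0 : EuclideanSpace ℝ (Fin d)) (2 * τ))) :=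
      ⟨by simpa using measure_closedBall_lt_top⟩
    have hlim : Tendsto (fun lam => ∫ y in Metric.closedBall (0 : EuclideanSpace ℝ (Fin d)) (2 * τ),
        covKernel C Q k (δ lam ^ d * lam) y * volume.real (R ∩ (fun x => x + δ lam • y) ⁻¹' R)) atTop
        (𝓝 (∫ y in Metric.closedBall (0 : EuclideanSpace ℝ (Fin d)) (2 * τ),
          covKernel C Q k ρ y * volume.real R)) := by
      -- The constant is the uniform covariance bound 2k² times ‖R‖, integrable on the ball of
      -- radius 2τ.
      refine tendsto_integral_filter_of_dominated_convergence
        (fun _ => 2 * (k : ℝ) ^ 2 * volume.real R) ?_ ?_ (integrable_const _)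
        (ae_of_all _ fun y => ?_)
      · refine Eventually.of_forall fun lam => ?_
        have hset : MeasurableSet {q : EuclideanSpace ℝ (Fin d) × EuclideanSpace ℝ (Fin d) |
            q.2 ∈ R ∧ q.2 + δ lam • q.1 ∈ R} :=
          (measurable_snd hR).inter ((by fun_prop : Measurable
            fun q : EuclideanSpace ℝ (Fin d) × EuclideanSpace ℝ (Fin d) => q.2 + δ lam • q.1) hR)
        have hvol := (measurable_measure_prodMk_left
          (ν := (volume : Measure (EuclideanSpace ℝ (Fin d)))) hset).ennreal_toReal
        exact ((measurable_covKernel hC hCτ k _).mul hvol).aestronglyMeasurable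
      · filter_upwards [eventually_gt_atTop 0] with lam hlam
        refine ae_of_all _ fun y => ?_
        rw [norm_mul]
        refine mul_le_mul ((hmodel lam hlam).abs_covKernel_le hlam.le (hδpos lam hlam) hC hCτ k y) ?_
          (norm_nonneg _) (by positivity)
        rw [Real.norm_of_nonneg measureReal_nonneg]
        exact measureReal_mono Set.inter_subset_left hRfin
      · exact (((continuous_covKernel k y).tendsto ρ).comp hδρ).mul
          (tendsto_volumeReal_inter_preimage_add_smul hR hRfin y hδ)
    rw [sigmaSq_eq hC hCτ]
    refine (hδρ.mul hlim).congr' ?_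
    filter_upwards [eventually_gt_atTop 0] with lam hlam
    rw [(hmodel lam hlam).variance_kVacancy hlam.le (hδpos lam hlam) hC hCτ hR hRfin k]
    ring
  refine ⟨fun lam hlam => (hmodel lam hlam).memLp_kVacancy (hδpos lam hlam) hRfin k, ?_, ?_, hvar⟩
  · have hcont : Continuous fun t : ℝ => volume.real R * ∑ m ∈ Finset.range k,
        Real.exp (-t) * t ^ m / (m ! : ℝ) := by fun_prop
    refine ((hcont.tendsto _).comp hβ).congr' ?_
    filter_upwards [eventually_gt_atTop 0] with lam hlam
    exact ((hmodel lam hlam).integral_kVacancy hlam.le (hδpos lam hlam) hC hCτ hRfin k).symm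
  · intro p hp
    have hvar0 : Tendsto (fun lam => Var[kVacancy (X lam) (S lam) (δ lam) R k; P lam]) atTop
        (𝓝 0) := by
      -- Var V_k = λ⁻¹ · (λ Var V_k), a null factor times a convergent one.
      have h := tendsto_inv_atTop_zero.mul hvar
      rw [zero_mul] at h
      refine h.congr' ?_
      filter_upwards [eventually_gt_atTop 0] with lam hlam
      rw [inv_mul_cancel_left₀ hlam.ne']
    have hup : Tendsto (fun lam => (2 * (k * volume.real R)) ^ (p - 1) *
        Real.sqrt (Var[kVacancy (X lam) (S lam) (δ lam) R k; P lam])) atTop (𝓝 0) := by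
      have h := ((Real.continuous_sqrt.tendsto 0).comp hvar0).const_mul
        ((2 * (k * volume.real R)) ^ (p - 1))
      rwa [Real.sqrt_zero, mul_zero] at h
    refine tendsto_of_tendsto_of_tendsto_of_le_of_le' tendsto_const_nhds hup
      (Eventually.of_forall fun lam => integral_nonneg fun ω => Real.rpow_nonneg (abs_nonneg _) _) ?_
    filter_upwards [eventually_gt_atTop 0] with lam hlam
    exact integral_abs_sub_rpow_le_sqrt_variance
      ((hmodel lam hlam).memLp_kVacancy (hδpos lam hlam) hRfin k)
      ((hmodel lam hlam).abs_kVacancy_le (hδpos lam hlam) hRfin k) hp
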